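/- Let $M$ be a compact connected one-manifold of class $C^1$, that is, a $C^1$ manifold (possibly with boundary) that is $C^1$-diffeomorphic to the interval $[0,1]$ or to the circle $\mathbb{S}^1$. Let $G$ be a countable group and let $\rho\colon G\to \mathrm{Homeo}(M)$ be a homomorphism (elements may reverse orientation). Assume that $\rho$ has subexponential growth of orbits: for every finite non-empty subset $S\subset G$ and every $x\in M$, $$\lim_{n\to\infty} |S^n x|^{1/n}=1,\qquad\text{where } S^n x=\{\rho(s_1\cdots s_n)(x) : s_1,\dots,s_n\in S\}.$$ A homomorphism $\hat\rho\colon G\to\mathrm{Homeo}(M)$ is called a blow-up of $\rho$ if there is a continuous surjective map $h\colon M\to M$ such that $h^{-1}(J)$ is connected for every connected set $J\subseteq M$ (the empty set counting as connected) and $h\circ\hat\rho(g)=\rho(g)\circ h$ for every $g\in G$. Then: 1. There is an action $\hat\rho$ of $G$ on $M$ by $C^1$ diffeomorphisms that is a blow-up of $\rho$. 2. More precisely, for every countable dense subset $X\subset M$ that is invariant under $\rho(G)$, there is an action $\hat\rho$ of $G$ on $M$ by $C^1$ diffeomorphisms that is a blow-up of $\rho$, by means of a map $h$ as above such that, for each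 $y\in M$, the fibre $h^{-1}(y)$ contains more than one point if and only if $y\in X$. -/

import Mathlib

open Set Filter Topology Pointwise
open scoped Manifold ContDiff

/-- Compact connected one-manifolds of class `C^1`: closed intervals and circles. That is, `M` is
`C^1`-diffeomorphic to `[0, 1]` or to the unit circle, both with their standard structures. -/
def IsCompactConnectedOneManifold {E : Type*} [NormedAddCommGroup E] [NormedSpace ℝ E]
    {H : Type*} [TopologicalSpace H] (I : ModelWithCorners ℝ E H)
    (M : Type*) [TopologicalSpace M] [ChartedSpace H M] : Prop :=
  Nonempty (Diffeomorph I (𝓡∂ 1) M (Icc (0 : ℝ) 1) 1) ∨ Nonempty (Diffeomorph I (𝓡 1) M Circle 1)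

/-- The action `ρ` has subexponential growth of orbits: for every finite nonempty `S ⊆ G` and every
point `x`, `|S^n x|^(1/n) → 1`, where `S^n x` is the set of all `s₁ ⋯ sₙ x` with `sᵢ ∈ S`. -/
def HasSubexpOrbitGrowth {G : Type*} [Group G] {M : Type*} [TopologicalSpace M]
    (ρ : G →* (M ≃ₜ M)) : Prop :=
  ∀ S : Set G, S.Finite → S.Nonempty → ∀ x : M,
    Tendsto (fun n : ℕ => (((fun g => ρ g x) '' (S ^ n)).ncard : ℝ) ^ (1 / (n : ℝ))) atTop (𝓝 1)

/-- `ρ` is an action by `C^1` diffeomorphisms (orientation-reversing ones are allowed). -/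
def IsC1Action {E : Type*} [NormedAddCommGroup E] [NormedSpace ℝ E]
    {H : Type*} [TopologicalSpace H] (I : ModelWithCorners ℝ E H)
    {G : Type*} [Group G] {M : Type*} [TopologicalSpace M] [ChartedSpace H M]
    (ρ : G →* (M ≃ₜ M)) : Prop :=
  ∀ g : G, ∃ φ : Diffeomorph I I M M 1, ∀ x : M, φ x = ρ g x

/-- `h` exhibits `ρ'` as a blow-up of `ρ`: it is a continuous surjection under which preimages of
connected sets are connected (the empty set included), and it intertwines `ρ'` with `ρ`. -/
structure IsBlowUpMap {G : Type*} [Group G] {M : Type*} [TopologicalSpace M]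
    (ρ' ρ : G →* (M ≃ₜ M)) (h : M → M) : Prop where
  continuous : Continuous h
  surjective : Function.Surjective h
  preimage_connected : ∀ J : Set M, IsPreconnected J → IsPreconnected (h ⁻¹' J)
  equivariant : ∀ (g : G) (x : M), h (ρ' g x) = ρ g (h x)

/-- `ρ'` is a blow-up of `ρ`. -/
def IsBlowUp {G : Type*} [Group G] {M : Type*} [TopologicalSpace M]
    (ρ' ρ : G →* (M ≃ₜ M)) : Prop :=
  ∃ h : M → M, IsBlowUpMap ρ' ρ h

/-- `ρ'` is obtained from `ρ` by blowing up exactly the points of `X`: for some blow-up map, the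
fibre over `y` (always a closed connected set) has more than one point if and only if `y ∈ X`. -/
def IsBlowUpAlong {G : Type*} [Group G] {M : Type*} [TopologicalSpace M]
    (ρ' ρ : G →* (M ≃ₜ M)) (X : Set M) : Prop :=
  ∃ h : M → M, IsBlowUpMap ρ' ρ h ∧ ∀ y : M, (h ⁻¹' {y}).Nontrivial ↔ y ∈ X

/-! The action is blown up in the manner of Denjoy: every point of a countable dense invariant set
`X` becomes an interval, and the lengths of these intervals are chosen so that neighbouring scales
match asymptotically.

Lengths. Exhaust `X` by finite sets `A n` built from orbit balls whose generating sets and base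
points grow slowly with `n`. Subexponential growth gives `|A n| ≤ exp (o(n))`. If `D y` is the first
`n` with `y ∈ A n`, each group element changes `D` by at most one outside a finite set. The weight
`exp (-L (D y))`, where `L` has increments tending to zero but still beats `log |A n|`, is therefore
summable, and `l (g y) / l y` tends to 1 along `X` (`exists_asymptotically_invariant_weight`).

Maps. A gap of length `a` is sent to one of length `b` by the projectivised linear map `diag (a,
b)`. These maps compose exactly (`gapMap_gapMap`), so the blow-ups form an action. They have
derivative 1 at the end points, and their derivative is within `|(b / a) ^ 2 - 1|` of 1.

Regularity. The candidate derivative is continuous because, locally, all but finitely many gaps have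
length ratio near 1. The open gaps have full measure and the complement goes into itself, so the
blow-up is the integral of this derivative (`GapHomeo.exists_contDiff`).

The interval is treated directly and the circle through lifts to the line; the two models are
carried to `M` by a diffeomorphism. The first claim is the second for the orbit of a countable dense
set. -/

/-! ### Asymptotically invariant weights from subexponential growth -/

section Weight

/-- Exhaustion data: finite sets `A n` with `∑ |A n| u n < ∞` give summability of `u ∘ D`, where
`D x` is an index with `x ∈ A (D x)`. -/
lemma summable_comp_of_mem_finite {M : Type*} (X : Set M) (A : ℕ → Set M) (hA : ∀ n, (A n).Finite)
    (u : ℕ → ℝ) (hu : ∀ n, 0 ≤ u n) (hsum : Summable fun n => ((A n).ncard : ℝ) * u n)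
    (D : M → ℕ) (hD : ∀ x ∈ X, x ∈ A (D x)) :
    Summable (X.indicator fun x => u (D x)) := by
  have hnn : ∀ x, 0 ≤ X.indicator (fun x => u (D x)) x := fun x =>
    indicator_nonneg (fun _ _ => hu _) x
  have key : ∑' x, ENNReal.ofReal (X.indicator (fun x => u (D x)) x) ≠ ⊤ := by
    have h1 : ∑' x, ENNReal.ofReal (X.indicator (fun x => u (D x)) x) ≤
        ∑' x, ∑' n, (A n).indicator (fun _ => ENNReal.ofReal (u n)) x := by
      refine ENNReal.tsum_le_tsum fun x => ?_
      by_cases hx : x ∈ X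
      · rw [indicator_of_mem hx]
        refine le_trans ?_ (ENNReal.le_tsum (D x))
        rw [indicator_of_mem (hD x hx)]
      · simp [indicator_of_notMem hx]
    rw [ENNReal.tsum_comm] at h1
    have h2 : ∀ n, ∑' x, (A n).indicator (fun _ => ENNReal.ofReal (u n)) x =
        ENNReal.ofReal ((A n).ncard * u n) := by
      intro n
      rw [tsum_eq_sum (s := (hA n).toFinset) (by
        intro x hx
        exact indicator_of_notMem (by simpa using hx) _)]
      rw [Finset.sum_congr rfl (g := fun _ => ENNReal.ofReal (u n)) (by
        intro x hx
        exact indicator_of_mem (by simpa using hx) _)]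
      rw [Finset.sum_const, nsmul_eq_mul, ENNReal.ofReal_mul (by positivity),
        ← Set.ncard_eq_toFinset_card _ (hA n), ENNReal.ofReal_natCast]
    simp_rw [h2] at h1
    exact ne_top_of_le_ne_top hsum.tsum_ofReal_ne_top h1
  have := ENNReal.summable_toReal key
  refine this.congr fun x => ?_
  rw [ENNReal.toReal_ofReal (hnn x)]

/-- The finite sets which exhaust an invariant countable set. -/
def orbitBall {G M : Type*} [Group G] [TopologicalSpace M] (ρ : G →* (M ≃ₜ M)) (S : ℕ → Set G)
    (x : ℕ → M) (k m : ℕ) : Set M :=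
  ⋃ i ∈ Finset.range (k + 1), (fun g => ρ g (x i)) '' (S k ^ m)

lemma orbitBall_finite {G M : Type*} [Group G] [TopologicalSpace M] (ρ : G →* (M ≃ₜ M))
    {S : ℕ → Set G} (hS : ∀ k, (S k).Finite) (x : ℕ → M) (k m : ℕ) :
    (orbitBall ρ S x k m).Finite := by
  refine Set.Finite.biUnion (Finset.finite_toSet _) fun i _ => Set.Finite.image _ ?_
  induction m with
  | zero => simp
  | succ m ih => rw [pow_succ]; exact ih.mul (hS k)

/-- Each of the `k + 1` orbits grows at exponential rate below half the allowed one; the spare half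
absorbs the factor `k + 1`. -/
lemma eventually_ncard_orbitBall_le {G M : Type*} [Group G] [TopologicalSpace M]
    (ρ : G →* (M ≃ₜ M)) (hρ : HasSubexpOrbitGrowth ρ)
    {S : ℕ → Set G} (hS : ∀ k, (S k).Finite) (hS1 : ∀ k, 1 ∈ S k) (x : ℕ → M) (k : ℕ) :
    ∀ᶠ m : ℕ in atTop, ((orbitBall ρ S x k m).ncard : ℝ) ≤ Real.exp (m * (1 / (k + 1))) := by
  have hk : (0 : ℝ) < 1 / (k + 1) := by positivity
  set c : ℝ := 1 / (k + 1) with hc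
  have h1 : ∀ i, ∀ᶠ m : ℕ in atTop,
      (((fun g => ρ g (x i)) '' (S k ^ m)).ncard : ℝ) ≤ Real.exp (m * (c / 2)) := by
    intro i
    have := (hρ (S k) (hS k) ⟨1, hS1 k⟩ (x i)).eventually
      (gt_mem_nhds (show (1 : ℝ) < Real.exp (c / 2) from by
        rw [← Real.exp_zero]; exact Real.exp_lt_exp.2 (by positivity)))
    filter_upwards [this, eventually_gt_atTop 0] with m hm hm0
    have hm0' : (m : ℝ) ≠ 0 := by positivity
    rw [mul_comm, Real.exp_mul]
    calc _ = ((((fun g => ρ g (x i)) '' (S k ^ m)).ncard : ℝ) ^ (1 / (m : ℝ))) ^ (m : ℝ) := by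
          rw [← Real.rpow_mul (by positivity)]; field_simp; simp
      _ ≤ _ := Real.rpow_le_rpow (by positivity) hm.le (by positivity)
  have h2 : ∀ᶠ m : ℕ in atTop, ((k : ℝ) + 1) ≤ Real.exp (m * (c / 2)) := by
    have : Tendsto (fun m : ℕ => Real.exp (m * (c / 2))) atTop atTop :=
      Real.tendsto_exp_atTop.comp
        (tendsto_natCast_atTop_atTop.atTop_mul_const (by positivity))
    exact this.eventually_ge_atTop _
  have h3 : ∀ᶠ m : ℕ in atTop, ∀ i ∈ Finset.range (k + 1),
      (((fun g => ρ g (x i)) '' (S k ^ m)).ncard : ℝ) ≤ Real.exp (m * (c / 2)) := by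
    rw [Filter.eventually_all_finset]
    exact fun i _ => h1 i
  filter_upwards [h2, h3] with m hm2 hm3
  have : ((orbitBall ρ S x k m).ncard : ℝ) ≤
      ∑ i ∈ Finset.range (k + 1), (((fun g => ρ g (x i)) '' (S k ^ m)).ncard : ℝ) := by
    exact_mod_cast Finset.set_ncard_biUnion_le _ _
  calc _ ≤ _ := this
    _ ≤ ∑ i ∈ Finset.range (k + 1), Real.exp (m * (c / 2)) := Finset.sum_le_sum hm3
    _ = (k + 1) * Real.exp (m * (c / 2)) := by simp
    _ ≤ Real.exp (m * (c / 2)) * Real.exp (m * (c / 2)) := by gcongr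
    _ = _ := by rw [← Real.exp_add]; ring_nf

/-- A countable invariant set of an action with subexponential growth of orbits carries a finite
atomic measure, of full support, which is asymptotically invariant at infinity. -/
theorem exists_asymptotically_invariant_weight {G M : Type*} [Group G] [Countable G]
    [TopologicalSpace M] (ρ : G →* (M ≃ₜ M)) (hρ : HasSubexpOrbitGrowth ρ)
    {X : Set M} (hX : X.Countable) (hne : X.Nonempty) (hinv : ∀ (g : G), ∀ x ∈ X, ρ g x ∈ X) :
    ∃ l : M → ℝ, (∀ x, 0 ≤ l x) ∧ (∀ x, l x ≠ 0 ↔ x ∈ X) ∧ HasSum l 1 ∧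
      ∀ (g : G) (ε : ℝ), 0 < ε → {x ∈ X | ε ≤ |l (ρ g x) / l x - 1|}.Finite := by
  classical
  obtain ⟨γ, hγ⟩ := exists_surjective_nat G
  obtain ⟨x, hx⟩ := hX.exists_eq_range hne
  have hxX : ∀ i, x i ∈ X := fun i => hx ▸ mem_range_self i
  -- The identity makes the powers of `S k` increase; inverses allow `D` to be compared in both
  -- directions.
  set S : ℕ → Set G := fun k => insert 1 (⋃ i ∈ Finset.range k, {γ i, (γ i)⁻¹}) with hSdef
  have hSf : ∀ k, (S k).Finite := fun k => Set.Finite.insert _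
    (Set.Finite.biUnion (Finset.finite_toSet _) fun i _ => Set.toFinite _)
  have hS1 : ∀ k, (1 : G) ∈ S k := fun k => mem_insert _ _
  have hSmono : Monotone S := by
    intro a b hab
    refine insert_subset_insert (biUnion_subset_biUnion_left ?_)
    intro i hi
    simp only [SetLike.mem_coe, Finset.mem_range] at hi ⊢
    omega
  have hSmem : ∀ g : G, ∃ k, g ∈ S k ∧ g⁻¹ ∈ S k := by
    intro g
    obtain ⟨i, rfl⟩ := hγ g
    refine ⟨i + 1, mem_insert_of_mem _ ?_, mem_insert_of_mem _ ?_⟩ <;>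
    · refine mem_biUnion (x := i) (by simp) (by simp)
  -- Asking for the bound at all `m ≥ n` makes `P` monotone in `n`, hence `κ` below monotone.
  set P : ℕ → ℕ → Prop := fun n k => ∀ m : ℕ, n ≤ m →
    ((orbitBall ρ S x k m).ncard : ℝ) ≤ Real.exp (m * (1 / (k + 1))) with hP
  have hPev : ∀ k, ∃ N, ∀ n, N ≤ n → P n k := by
    intro k
    obtain ⟨N, hN⟩ := eventually_atTop.1 (eventually_ncard_orbitBall_le ρ hρ hSf hS1 x k)
    exact ⟨N, fun n hn m hm => hN m (hn.trans hm)⟩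
  -- The largest admissible `k ≤ n`, so `κ` tends to infinity. The default value 0 can violate `P`
  -- only for `n < N₀`.
  set κ : ℕ → ℕ := fun n => Nat.findGreatest (P n) n with hκ
  have hκmono : Monotone κ := by
    intro a b hab
    exact Nat.findGreatest_mono (fun k hk m hm => hk m (hab.trans hm)) hab
  have hκtop : ∀ k, ∃ N, ∀ n, N ≤ n → k ≤ κ n := by
    intro k
    obtain ⟨N, hN⟩ := hPev k
    refine ⟨max N k, fun n hn => Nat.le_findGreatest ((le_max_right _ _).trans hn)
      (hN n ((le_max_left _ _).trans hn))⟩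
  obtain ⟨N₀, hN₀⟩ := hPev 0
  have hκP : ∀ n, N₀ ≤ n → P n (κ n) := fun n hn =>
    Nat.findGreatest_spec (P := P n) (Nat.zero_le n) (hN₀ n hn)
  set A : ℕ → Set M := fun n => orbitBall ρ S x (κ n) n with hA
  have hAf : ∀ n, (A n).Finite := fun n => orbitBall_finite ρ hSf x _ _
  have hAstep : ∀ n, ∀ s ∈ S (κ n), ∀ y ∈ A n, ρ s y ∈ A (n + 1) := by
    intro n s hs y hy
    simp only [hA, orbitBall, mem_iUnion, mem_image, Finset.mem_range] at hy ⊢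
    obtain ⟨i, hi, g, hg, rfl⟩ := hy
    have hk := hκmono (Nat.le_succ n)
    refine ⟨i, lt_of_lt_of_le hi (by simpa using hk), s * g, ?_, by simp⟩
    rw [pow_succ']
    exact mul_mem_mul (hSmono hk hs) (Set.pow_subset_pow_left (hSmono hk) hg)
  have hAmono : Monotone A := monotone_nat_of_le_succ fun n y hy => by
    simpa using hAstep n 1 (hS1 _) y hy
  have hAX : ∀ y ∈ X, ∃ n, y ∈ A n := by
    intro y hy
    rw [hx] at hy
    obtain ⟨i, rfl⟩ := hy
    obtain ⟨N, hN⟩ := hκtop i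
    refine ⟨N, ?_⟩
    simp only [hA, orbitBall, mem_iUnion, mem_image, Finset.mem_range]
    exact ⟨i, Nat.lt_succ_of_le (hN N le_rfl), 1, Set.one_mem_pow (hS1 _), by simp⟩
  set D : M → ℕ := fun y => sInf {n | y ∈ A n} with hD
  have hDmem : ∀ y ∈ X, y ∈ A (D y) := fun y hy => Nat.sInf_mem (s := {n | y ∈ A n}) (hAX y hy)
  have hDle : ∀ y n, y ∈ A n → D y ≤ n := fun y n h => Nat.sInf_le h
  -- The increments tend to 0 since `κ` tends to infinity. As `κ` is monotone, the sum is at least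
  -- `2n / (κ n + 1)`, which beats the growth of `A n`; the logarithm leaves a factor `1 / (n + 1) ^
  -- 2`.
  set L : ℕ → ℝ := fun n => (∑ m ∈ Finset.range n, 2 * (1 / ((κ m : ℝ) + 1))) +
    2 * Real.log (n + 1) with hL
  have hLge : ∀ n : ℕ, 2 * n * (1 / ((κ n : ℝ) + 1)) + 2 * Real.log (n + 1) ≤ L n := by
    intro n
    simp only [hL]
    gcongr
    calc 2 * n * (1 / ((κ n : ℝ) + 1))
        = ∑ m ∈ Finset.range n, 2 * (1 / ((κ n : ℝ) + 1)) := by simp; ring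
      _ ≤ _ := by
        refine Finset.sum_le_sum fun m hm => ?_
        have : (κ m : ℝ) ≤ κ n := by exact_mod_cast hκmono (Finset.mem_range.1 hm).le
        gcongr
  have hsum : Summable fun n => ((A n).ncard : ℝ) * Real.exp (-L n) := by
    have hs : Summable fun n : ℕ => 1 / ((n + 1 : ℕ) : ℝ) ^ 2 :=
      (summable_nat_add_iff (f := fun n : ℕ => 1 / (n : ℝ) ^ 2) 1).2
        (Real.summable_one_div_nat_pow.2 one_lt_two)
    refine hs.of_norm_bounded_eventually_nat ?_
    filter_upwards [eventually_ge_atTop N₀] with n hn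
    rw [Real.norm_of_nonneg (by positivity)]
    have h1 := hκP n hn n le_rfl
    calc ((A n).ncard : ℝ) * Real.exp (-L n)
        ≤ Real.exp (n * (1 / (κ n + 1))) *
          Real.exp (-(n * (1 / ((κ n : ℝ) + 1)) + 2 * Real.log (n + 1))) := by
          refine mul_le_mul h1 (Real.exp_le_exp.2 ?_) (by positivity) (by positivity)
          have := hLge n
          have : (0 : ℝ) ≤ n * (1 / ((κ n : ℝ) + 1)) := by positivity
          linarith
      _ = Real.exp (-(2 * Real.log (n + 1))) := by rw [← Real.exp_add]; ring_nf
      _ = 1 / ((n + 1 : ℕ) : ℝ) ^ 2 := by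
          rw [Real.exp_neg, mul_comm, Real.exp_mul, Real.exp_log (by positivity)]
          push_cast; simp
  have hLstep : ∀ δ : ℝ, 0 < δ → ∃ N, ∀ n, N ≤ n → |L (n + 1) - L n| < δ := by
    intro δ hδ
    have ht : Tendsto (fun n : ℕ => L (n + 1) - L n) atTop (𝓝 0) := by
      have e : ∀ n : ℕ, L (n + 1) - L n = 2 * (1 / ((κ n : ℝ) + 1)) +
          2 * Real.log (1 + 1 / ((n : ℝ) + 1)) := by
        intro n
        have : Real.log (1 + 1 / ((n : ℝ) + 1)) = Real.log (n + 1 + 1) - Real.log (n + 1) := by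
          rw [← Real.log_div (by positivity) (by positivity)]
          congr 1; field_simp
        rw [this]
        simp only [hL, Finset.sum_range_succ]; push_cast; ring
      simp_rw [e]
      have hκt : Tendsto κ atTop atTop := tendsto_atTop.2 fun k => by
        obtain ⟨N, hN⟩ := hκtop k
        exact eventually_atTop.2 ⟨N, hN⟩
      have t1 : Tendsto (fun n => 1 / ((κ n : ℝ) + 1)) atTop (𝓝 0) :=
        (tendsto_one_div_add_atTop_nhds_zero_nat (𝕜 := ℝ)).comp hκt
      have t2 : Tendsto (fun n : ℕ => Real.log (1 + 1 / ((n : ℝ) + 1))) atTop (𝓝 0) := by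
        have := ((tendsto_one_div_add_atTop_nhds_zero_nat (𝕜 := ℝ)).const_add 1).log (by norm_num)
        simpa using this
      simpa using (t1.const_mul 2).add (t2.const_mul 2)
    obtain ⟨N, hN⟩ := eventually_atTop.1 (ht.eventually (Metric.ball_mem_nhds 0 hδ))
    exact ⟨N, fun n hn => by simpa [Real.dist_eq] using hN n hn⟩
  set l₀ : M → ℝ := X.indicator fun y => Real.exp (-L (D y)) with hl₀
  have hl₀s : Summable l₀ := summable_comp_of_mem_finite X A hAf (fun n => Real.exp (-L n))
    (fun n => (Real.exp_pos _).le) hsum D hDmem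
  have hl₀nn : ∀ y, 0 ≤ l₀ y := fun y => indicator_nonneg (fun _ _ => (Real.exp_pos _).le) y
  have hl₀ne : ∀ y, l₀ y ≠ 0 ↔ y ∈ X := by
    intro y
    by_cases hy : y ∈ X
    · simp [hl₀, hy, (Real.exp_pos _).ne']
    · simp [hl₀, hy]
  have hpos : 0 < ∑' y, l₀ y := by
    obtain ⟨y, hy⟩ := hne
    exact hl₀s.tsum_pos hl₀nn y (lt_of_le_of_ne (hl₀nn y) ((hl₀ne y).2 hy).symm)
  refine ⟨fun y => l₀ y / ∑' z, l₀ z, fun y => div_nonneg (hl₀nn y) hpos.le, fun y => ?_, ?_, ?_⟩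
  · rw [← hl₀ne, ne_eq, div_eq_zero_iff, not_or]
    exact ⟨fun h => h.1, fun h => ⟨h, hpos.ne'⟩⟩
  · simpa [div_self hpos.ne'] using hl₀s.hasSum.div_const (∑' z, l₀ z)
  · intro g ε hε
    obtain ⟨k, hk1, hk2⟩ := hSmem g
    obtain ⟨N₁, hN₁⟩ := hκtop k
    obtain ⟨δ, hδ, hδε⟩ := Metric.continuousAt_iff.1 (Real.continuous_exp.continuousAt (x := 0)) ε hε
    obtain ⟨N₂, hN₂⟩ := hLstep δ hδ
    set N := max N₁ N₂
    -- Off this finite set both `y` and `ρ g y` first appear at stage `N` or later, where `g` and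
    -- its inverse are available generators and `L` is nearly constant over one step.
    refine ((hAf N).union ((hAf N).preimage
      ((ρ g).injective.injOn (s := _)))).subset ?_
    rintro y ⟨hyX, hy⟩
    by_contra hcon
    simp only [mem_union, mem_preimage, not_or] at hcon
    have hgX := hinv g y hyX
    have ha : N ≤ D y := by
      by_contra! h
      exact hcon.1 (hAmono h.le (hDmem y hyX))
    have hb : N ≤ D (ρ g y) := by
      by_contra! h
      exact hcon.2 (hAmono h.le (hDmem _ hgX))
    have h1 : D (ρ g y) ≤ D y + 1 := hDle _ _ (hAstep _ g
      (hSmono (hN₁ _ ((le_max_left _ _).trans ha)) hk1) y (hDmem y hyX))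
    have h2 : D y ≤ D (ρ g y) + 1 := by
      have := hAstep _ g⁻¹ (hSmono (hN₁ _ ((le_max_left _ _).trans hb)) hk2) _ (hDmem _ hgX)
      refine hDle _ _ ?_
      simpa using this
    have hd : |L (D y) - L (D (ρ g y))| < δ := by
      rcases lt_trichotomy (D y) (D (ρ g y)) with h | h | h
      · have e : D (ρ g y) = D y + 1 := by omega
        rw [e, abs_sub_comm]
        exact hN₂ _ ((le_max_right _ _).trans ha)
      · rw [h]; simpa using hδ
      · have e : D y = D (ρ g y) + 1 := by omega
        rw [e]
        exact hN₂ _ ((le_max_right _ _).trans hb)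
    have := hδε (x := L (D y) - L (D (ρ g y))) (by simpa [Real.dist_eq] using hd)
    rw [Real.exp_zero, Real.dist_eq] at this
    have e : l₀ (ρ g y) / (∑' z, l₀ z) / (l₀ y / ∑' z, l₀ z) =
        Real.exp (L (D y) - L (D (ρ g y))) := by
      rw [div_div_div_cancel_right₀ hpos.ne']
      simp only [hl₀, indicator_of_mem hgX, indicator_of_mem hyX]
      rw [← Real.exp_sub]; ring_nf
    simp only [e] at hy
    exact absurd hy (not_le.2 this)

end Weight

/-! ### The model diffeomorphisms between gaps -/

section GapMap

/-- The map `[-a/2, a/2] → [-b/2, b/2]` which is conjugate to the linear map `diag (a, b)` acting on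
the directions of the right half plane, the direction of angle `θ` being identified with the
points `a θ / π` and `b θ / π`. These maps are tangent to the identity at the end points. -/
noncomputable def gapMap (a b t : ℝ) : ℝ :=
  b / Real.pi * Complex.arg ⟨a * Real.cos (Real.pi * t / a), b * Real.sin (Real.pi * t / a)⟩

/-- The derivative of `gapMap a b`. -/
noncomputable def gapDeriv (a b t : ℝ) : ℝ :=
  b ^ 2 / (a ^ 2 * Real.cos (Real.pi * t / a) ^ 2 + b ^ 2 * Real.sin (Real.pi * t / a) ^ 2)

variable {a b c t : ℝ}

lemma gapDeriv_denom_pos (ha : 0 < a) (hb : 0 < b) (θ : ℝ) :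
    0 < a ^ 2 * Real.cos θ ^ 2 + b ^ 2 * Real.sin θ ^ 2 := by
  by_cases h : Real.cos θ = 0
  · have := Real.sin_sq_add_cos_sq θ
    rw [h] at this ⊢
    have e : Real.sin θ ^ 2 = 1 := by linarith
    rw [e]; positivity
  · positivity

lemma gapDeriv_pos (ha : 0 < a) (hb : 0 < b) (t : ℝ) : 0 < gapDeriv a b t :=
  div_pos (by positivity) (gapDeriv_denom_pos ha hb _)

lemma continuous_gapDeriv (ha : 0 < a) (hb : 0 < b) : Continuous (gapDeriv a b) := by
  unfold gapDeriv
  refine Continuous.div (by fun_prop) (by fun_prop) fun t => (gapDeriv_denom_pos ha hb _).ne'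

/-- The difference is `(b / a) ^ 2 - 1` times a fraction in `[0, 1]`, which gives a bound uniform
over the gap. -/
lemma abs_gapDeriv_sub_one_le (ha : 0 < a) (hb : 0 < b) (t : ℝ) :
    |gapDeriv a b t - 1| ≤ |(b / a) ^ 2 - 1| := by
  unfold gapDeriv
  set θ := Real.pi * t / a
  have hd := gapDeriv_denom_pos ha hb θ
  have hs := Real.sin_sq_add_cos_sq θ
  have e1 : b ^ 2 / (a ^ 2 * Real.cos θ ^ 2 + b ^ 2 * Real.sin θ ^ 2) - 1 =
      (b ^ 2 - a ^ 2) / a ^ 2 * (a ^ 2 * Real.cos θ ^ 2 /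
        (a ^ 2 * Real.cos θ ^ 2 + b ^ 2 * Real.sin θ ^ 2)) := by
    have : Real.sin θ ^ 2 = 1 - Real.cos θ ^ 2 := by linarith
    rw [this] at hd ⊢
    field_simp
    ring
  have e2 : (b / a) ^ 2 - 1 = (b ^ 2 - a ^ 2) / a ^ 2 := by field_simp
  rw [e1, e2, abs_mul]
  refine mul_le_of_le_one_right (abs_nonneg _) ?_
  rw [abs_of_nonneg (by positivity), div_le_one hd]
  have : 0 ≤ b ^ 2 * Real.sin θ ^ 2 := by positivity
  linarith

lemma gapDeriv_half (ha : 0 < a) (hb : 0 < b) : gapDeriv a b (a / 2) = 1 := by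
  have : Real.pi * (a / 2) / a = Real.pi / 2 := by field_simp
  simp [gapDeriv, this, hb.ne']

lemma gapDeriv_neg_half (ha : 0 < a) (hb : 0 < b) : gapDeriv a b (-(a / 2)) = 1 := by
  have : Real.pi * (-(a / 2)) / a = -(Real.pi / 2) := by field_simp
  simp only [gapDeriv, this, Real.cos_neg, Real.sin_neg]
  simp [hb.ne']

lemma gapMap_half (ha : 0 < a) (hb : 0 < b) : gapMap a b (a / 2) = b / 2 := by
  have : Real.pi * (a / 2) / a = Real.pi / 2 := by field_simp
  have e : (⟨0, b⟩ : ℂ) = (b : ℝ) * Complex.I := by apply Complex.ext <;> simp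
  simp only [gapMap, this, Real.cos_pi_div_two, Real.sin_pi_div_two, mul_zero, mul_one]
  rw [e, Complex.arg_real_mul _ hb, Complex.arg_I]
  field_simp

/-- Division by zero and `arg 0 = 0` give the right value for a degenerate gap, so points that are
not blown up obey the same formula. -/
lemma gapMap_zero_left (b t : ℝ) : gapMap 0 b t = 0 := by
  have : (⟨0, 0⟩ : ℂ) = 0 := rfl
  simp [gapMap, this]

lemma abs_angle_le (ha : 0 < a) (ht : |t| ≤ a / 2) : |Real.pi * t / a| ≤ Real.pi / 2 := by
  have := Real.pi_pos
  rw [abs_div, abs_mul, abs_of_pos this, abs_of_pos ha, div_le_iff₀ ha]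
  nlinarith

lemma cos_angle_nonneg (ha : 0 < a) (ht : |t| ≤ a / 2) : 0 ≤ Real.cos (Real.pi * t / a) :=
  Real.cos_nonneg_of_mem_Icc (abs_le.1 (abs_angle_le ha ht))

lemma abs_gapMap_le (ha : 0 ≤ a) (hb : 0 ≤ b) (ht : |t| ≤ a / 2) : |gapMap a b t| ≤ b / 2 := by
  rcases ha.eq_or_lt with rfl | ha
  · rw [gapMap_zero_left, abs_zero]; positivity
  have hπ := Real.pi_pos
  unfold gapMap
  have h := Complex.abs_arg_le_pi_div_two_iff (z := ⟨a * Real.cos (Real.pi * t / a),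
    b * Real.sin (Real.pi * t / a)⟩) |>.2 (mul_nonneg ha.le (cos_angle_nonneg ha ht))
  rw [abs_mul, abs_of_nonneg (by positivity)]
  calc _ ≤ b / Real.pi * (Real.pi / 2) := by gcongr
    _ = b / 2 := by field_simp

/-- `diag (b, c)` after `diag (a, b)` is `b` times `diag (a, c)`, and a positive factor does not
change directions. -/
lemma gapMap_gapMap (ha : 0 < a) (hb : 0 < b) (c t : ℝ) :
    gapMap b c (gapMap a b t) = gapMap a c t := by
  have hπ := Real.pi_pos
  set θ := Real.pi * t / a with hθ
  set z : ℂ := ⟨a * Real.cos θ, b * Real.sin θ⟩ with hz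
  have hz0 : z ≠ 0 := by
    intro h
    have h1 : a * Real.cos θ = 0 := congrArg Complex.re h
    have h2 : b * Real.sin θ = 0 := congrArg Complex.im h
    have := gapDeriv_denom_pos ha hb θ
    nlinarith
  have e1 : Real.pi * gapMap a b t / b = z.arg := by
    simp only [gapMap, ← hθ, ← hz]; field_simp
  have hn : 0 < ‖z‖ := norm_pos_iff.2 hz0
  have h1 : ‖z‖ * Real.cos z.arg = a * Real.cos θ := Complex.norm_mul_cos_arg z
  have h2 : ‖z‖ * Real.sin z.arg = b * Real.sin θ := Complex.norm_mul_sin_arg z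
  have e2 : (⟨a * Real.cos θ, c * Real.sin θ⟩ : ℂ) =
      ((‖z‖ / b : ℝ) : ℂ) * ⟨b * Real.cos z.arg, c * Real.sin z.arg⟩ := by
    apply Complex.ext
    · rw [Complex.re_ofReal_mul, ← h1]; field_simp
    · rw [Complex.im_ofReal_mul]
      have : Real.sin θ = ‖z‖ * Real.sin z.arg / b := by rw [h2]; field_simp
      simp only [this]; field_simp
  rw [gapMap, e1, gapMap, ← hθ, e2, Complex.arg_real_mul _ (by positivity)]

lemma gapMap_self (ha : 0 ≤ a) (ht : |t| ≤ a / 2) : gapMap a a t = t := by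
  rcases ha.eq_or_lt with rfl | ha
  · have : |t| ≤ 0 := by simpa using ht
    rw [gapMap_zero_left, abs_nonpos_iff.1 this]
  have hπ := Real.pi_pos
  have hθ := abs_le.1 (abs_angle_le ha ht)
  have e : ∀ θ : ℝ, (⟨a * Real.cos θ, a * Real.sin θ⟩ : ℂ) =
      a * (Complex.cos (θ : ℂ) + Complex.sin (θ : ℂ) * Complex.I) := fun θ => by
    rw [← Complex.ofReal_cos, ← Complex.ofReal_sin]
    apply Complex.ext <;> simp [-Complex.ofReal_cos, -Complex.ofReal_sin]
  rw [gapMap, e, Complex.arg_mul_cos_add_sin_mul_I ha ⟨by linarith, by linarith⟩]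
  field_simp

/-- Reflection in the real axis negates the argument except on the negative axis, which the right
half plane avoids. This is what accommodates orientation-reversing elements. -/
lemma gapMap_neg (ha : 0 < a) (b : ℝ) (ht : |t| ≤ a / 2) : gapMap a b (-t) = -gapMap a b t := by
  have hπ := Real.pi_pos
  have h := Complex.abs_arg_le_pi_div_two_iff (z := ⟨a * Real.cos (Real.pi * t / a),
    b * Real.sin (Real.pi * t / a)⟩) |>.2 (mul_nonneg ha.le (cos_angle_nonneg ha ht))
  have e : Real.pi * -t / a = -(Real.pi * t / a) := by ring
  have e2 : (⟨a * Real.cos (Real.pi * t / a), b * -Real.sin (Real.pi * t / a)⟩ : ℂ) =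
    (starRingEnd ℂ) ⟨a * Real.cos (Real.pi * t / a), b * Real.sin (Real.pi * t / a)⟩ := by
    apply Complex.ext <;> simp
  simp only [gapMap]
  rw [e, Real.cos_neg, Real.sin_neg, e2, Complex.arg_conj, if_neg]
  · ring
  · intro h'
    rw [h', abs_of_pos hπ] at h
    linarith

lemma gapMap_neg_half (ha : 0 < a) (hb : 0 < b) : gapMap a b (-(a / 2)) = -(b / 2) := by
  rw [gapMap_neg ha b (by rw [abs_of_pos (by positivity)]), gapMap_half ha hb]

lemma hasDerivAt_gapMap (ha : 0 < a) (hb : 0 < b) (ht : |t| ≤ a / 2) :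
    HasDerivAt (gapMap a b) (gapDeriv a b t) t := by
  have hπ := Real.pi_pos
  have hd := gapDeriv_denom_pos ha hb (Real.pi * t / a)
  have hcos := cos_angle_nonneg ha ht
  have hθ : HasDerivAt (fun s : ℝ => Real.pi * s / a) (Real.pi / a) t := by
    simpa using ((hasDerivAt_id t).const_mul Real.pi).div_const a
  have h1 := (hθ.cos.const_mul a)
  have h2 := (hθ.sin.const_mul b)
  set θ := Real.pi * t / a
  have h3 : HasDerivAt (fun s : ℝ => ((a * Real.cos (Real.pi * s / a) : ℝ) : ℂ) +
      ((b * Real.sin (Real.pi * s / a) : ℝ) : ℂ) * Complex.I) _ t :=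
    h1.ofReal_comp.add (h2.ofReal_comp.mul_const Complex.I)
  -- At the end points of the gap the vector is a nonzero imaginary number, still off the branch
  -- cut; `arg` is the imaginary part of `log`.
  have hmem : ((a * Real.cos θ : ℝ) : ℂ) + ((b * Real.sin θ : ℝ) : ℂ) * Complex.I ∈
      Complex.slitPlane := by
    rw [Complex.mem_slitPlane_iff]
    rcases hcos.eq_or_lt with h | h
    · right
      rw [← h] at hd
      have : Real.sin θ ≠ 0 := by rintro h; rw [h] at hd; simp at hd
      simpa only [Complex.add_im, Complex.ofReal_im, Complex.mul_im, Complex.I_re, Complex.I_im,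
        Complex.ofReal_re, mul_zero, mul_one, add_zero, zero_add] using mul_ne_zero hb.ne' this
    · left
      simp only [Complex.add_re, Complex.ofReal_re, Complex.mul_re, Complex.I_re, Complex.ofReal_im,
        Complex.I_im]
      nlinarith [mul_pos ha h]
  have h4 := (Complex.imCLM.hasFDerivAt.comp_hasDerivAt t (h3.clog_real hmem)).const_mul (b / Real.pi)
  have e : gapMap a b = fun s => b / Real.pi * Complex.imCLM (Complex.log
      (((a * Real.cos (Real.pi * s / a) : ℝ) : ℂ) +
        ((b * Real.sin (Real.pi * s / a) : ℝ) : ℂ) * Complex.I)) := by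
    funext s
    simp only [Complex.imCLM_apply, Complex.log_im, gapMap]
    rw [Complex.mk_eq_add_mul_I]
  rw [e]
  refine h4.congr_deriv ?_
  unfold gapDeriv
  simp only [Complex.imCLM_apply, Complex.div_im, Complex.normSq_apply, Complex.add_re,
    Complex.add_im, Complex.ofReal_re, Complex.ofReal_im, Complex.mul_re, Complex.mul_im,
    Complex.I_re, Complex.I_im, mul_zero, mul_one, sub_zero, add_zero, zero_add]
  have hs := Real.sin_sq_add_cos_sq θ
  have e5 : a * Real.cos θ * (a * Real.cos θ) + b * Real.sin θ * (b * Real.sin θ) =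
    a ^ 2 * Real.cos θ ^ 2 + b ^ 2 * Real.sin θ ^ 2 := by ring
  change _ = b ^ 2 / (a ^ 2 * Real.cos θ ^ 2 + b ^ 2 * Real.sin θ ^ 2)
  rw [e5]
  generalize a ^ 2 * Real.cos θ ^ 2 + b ^ 2 * Real.sin θ ^ 2 = N at hd ⊢
  have := hd.ne'
  field_simp
  linear_combination hs

lemma strictMonoOn_gapMap (ha : 0 < a) (hb : 0 < b) :
    StrictMonoOn (gapMap a b) (Icc (-(a / 2)) (a / 2)) := by
  refine strictMonoOn_of_deriv_pos (convex_Icc _ _)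
    (fun t ht => (hasDerivAt_gapMap ha hb (abs_le.2 ht)).continuousAt.continuousWithinAt)
    fun t ht => ?_
  have ht' : t ∈ Icc (-(a / 2)) (a / 2) := interior_subset ht
  rw [(hasDerivAt_gapMap ha hb (abs_le.2 ht')).deriv]
  exact gapDeriv_pos ha hb t

/-- `gapDeriv a b - 1`, extended by zero outside the gap. -/
noncomputable def gapBump (a b t : ℝ) : ℝ := gapDeriv a b (max (-(a / 2)) (min t (a / 2))) - 1

lemma continuous_gapBump (ha : 0 < a) (hb : 0 < b) : Continuous (gapBump a b) :=
  ((continuous_gapDeriv ha hb).comp (by fun_prop)).sub continuous_const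

lemma gapBump_of_le (ht : |t| ≤ a / 2) : gapBump a b t = gapDeriv a b t - 1 := by
  rw [gapBump, min_eq_left (abs_le.1 ht).2, max_eq_right (abs_le.1 ht).1]

lemma gapBump_of_lt (ha : 0 < a) (hb : 0 < b) (ht : a / 2 < |t|) : gapBump a b t = 0 := by
  rcases lt_abs.1 ht with h | h
  · rw [gapBump, min_eq_right h.le, max_eq_right (by linarith), gapDeriv_half ha hb, sub_self]
  · rw [gapBump, min_eq_left (by linarith), max_eq_left (by linarith), gapDeriv_neg_half ha hb,
      sub_self]

end GapMap

/-! ### Blow-up of a single homeomorphism and its `C^1` regularity -/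

section Blowup

/-- The points `x` of a closed interval `D` of the line are replaced by closed intervals ("gaps") of
center `c x` and length `w x`, which partition `D`, and `h` collapses these intervals. The union of
the open gaps has full measure. -/
structure GapData (D : Set ℝ) (w c h : ℝ → ℝ) : Prop where
  isClosed : IsClosed D
  ordConnected : D.OrdConnected
  nonneg : ∀ x, 0 ≤ w x
  mapsTo : ∀ t ∈ D, h t ∈ D
  abs_sub_le : ∀ t ∈ D, |t - c (h t)| ≤ w (h t) / 2
  of_abs_sub_le : ∀ x ∈ D, ∀ t, |t - c x| ≤ w x / 2 → t ∈ D ∧ h t = x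
  monotoneOn : MonotoneOn h D
  exists_bound : ∃ C : ℝ, ∀ t ∈ D, |h t - t| ≤ C
  null : MeasureTheory.volume {t | t ∈ D ∧ w (h t) / 2 ≤ |t - c (h t)|} = 0

/-- A homeomorphism of `D`, increasing if `σ = 1` and decreasing if `σ = -1`, which preserves the
support of `w` and changes the weights less and less at infinity. -/
structure GapHomeo (D : Set ℝ) (w : ℝ → ℝ) (σ : ℝ) (F : ℝ → ℝ) : Prop where
  sign : σ = 1 ∨ σ = -1
  mapsTo : ∀ x ∈ D, F x ∈ D
  surjOn : SurjOn F D D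
  strictMono : ∀ x ∈ D, ∀ y ∈ D, x < y → σ * F x < σ * F y
  weight_eq_zero : ∀ x ∈ D, (w (F x) = 0 ↔ w x = 0)
  finite : ∀ ε : ℝ, 0 < ε → ∀ a b : ℝ,
    {x | x ∈ D ∧ x ∈ Icc a b ∧ w x ≠ 0 ∧ ε ≤ |w (F x) / w x - 1|}.Finite

/-- The blow-up of the map `F`. -/
noncomputable def blowup (w c h : ℝ → ℝ) (σ : ℝ) (F : ℝ → ℝ) (t : ℝ) : ℝ :=
  c (F (h t)) + σ * gapMap (w (h t)) (w (F (h t))) (t - c (h t))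

open Classical in
/-- The absolute value of the derivative of `blowup w c h σ F`. -/
noncomputable def blowupDeriv (w c h : ℝ → ℝ) (F : ℝ → ℝ) (t : ℝ) : ℝ :=
  if w (h t) = 0 then 1 else gapDeriv (w (h t)) (w (F (h t))) (t - c (h t))

variable {D : Set ℝ} {w c h : ℝ → ℝ} {σ τ : ℝ} {F F' : ℝ → ℝ}

lemma abs_sign_mul (hσ : σ = 1 ∨ σ = -1) (x : ℝ) : |σ * x| = |x| := by
  rcases hσ with rfl | rfl <;> simp

lemma GapData.blowup_mem (H : GapData D w c h) (hσ : σ = 1 ∨ σ = -1) {t : ℝ} (ht : t ∈ D)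
    (hF : F (h t) ∈ D) :
    blowup w c h σ F t ∈ D ∧ h (blowup w c h σ F t) = F (h t) := by
  refine H.of_abs_sub_le _ hF _ ?_
  rw [blowup, add_sub_cancel_left, abs_sign_mul hσ]
  exact abs_gapMap_le (H.nonneg _) (H.nonneg _) (H.abs_sub_le t ht)

lemma sign_mul_gapMap (hσ : σ = 1 ∨ σ = -1) {a b t : ℝ} (ha : 0 ≤ a) (ht : |t| ≤ a / 2) :
    gapMap a b (σ * t) = σ * gapMap a b t := by
  rcases hσ with rfl | rfl
  · simp
  · rcases ha.eq_or_lt with rfl | ha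
    · simp [gapMap_zero_left]
    · simpa using gapMap_neg ha b ht

/-- Signs move out of `gapMap` by oddness and the gap maps compose exactly. The condition on weights
keeps the middle gap from degenerating. -/
lemma GapData.blowup_blowup (H : GapData D w c h) (hσ : σ = 1 ∨ σ = -1)
    {t : ℝ} (ht : t ∈ D) (hF : F (h t) ∈ D) (hw : w (F (h t)) = 0 ↔ w (h t) = 0) :
    blowup w c h τ F' (blowup w c h σ F t) = blowup w c h (τ * σ) (F' ∘ F) t := by
  have h1 := (H.blowup_mem hσ ht hF).2
  conv_lhs => rw [blowup, h1]
  rw [blowup, add_sub_cancel_left, blowup, Function.comp_apply, mul_assoc]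
  have h3 := abs_gapMap_le (H.nonneg (h t)) (H.nonneg (F (h t))) (H.abs_sub_le t ht)
  rw [sign_mul_gapMap hσ (H.nonneg _) h3]
  congr 3
  rcases (H.nonneg (h t)).eq_or_lt with h4 | h4
  · rw [hw.2 h4.symm, ← h4, gapMap_zero_left, gapMap_zero_left]
  · refine gapMap_gapMap h4 (lt_of_le_of_ne (H.nonneg _) fun h5 => ?_) _ _
    exact h4.ne' (hw.1 h5.symm)

/-- Serves for the identity element, and on the circle for its lifts, which are integer
translations. -/
lemma GapData.blowup_of_weight_eq (H : GapData D w c h) {t : ℝ} (ht : t ∈ D)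
    (hw : w (F (h t)) = w (h t)) :
    blowup w c h 1 F t = t + (c (F (h t)) - c (h t)) := by
  rw [blowup, hw, gapMap_self (H.nonneg _) (H.abs_sub_le t ht)]
  ring

lemma GapHomeo.weight_pos (hF : GapHomeo D w σ F) (H : GapData D w c h) {x : ℝ} (hx : x ∈ D)
    (hw : 0 < w x) : 0 < w (F x) :=
  lt_of_le_of_ne (H.nonneg _) fun h5 => hw.ne' ((hF.weight_eq_zero x hx).1 h5.symm)

lemma GapHomeo.sign_sq (hF : GapHomeo D w σ F) : σ * σ = 1 := by
  rcases hF.sign with rfl | rfl <;> norm_num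

lemma GapHomeo.blowup_strictMono (hF : GapHomeo D w σ F) (H : GapData D w c h) :
    StrictMonoOn (fun t => σ * blowup w c h σ F t) D := by
  intro s hs t ht hst
  have h1 := H.blowup_mem hF.sign hs (hF.mapsTo _ (H.mapsTo _ hs))
  have h2 := H.blowup_mem hF.sign ht (hF.mapsTo _ (H.mapsTo _ ht))
  rcases (H.monotoneOn hs ht hst.le).eq_or_lt with he | hlt
  · have hs' := H.abs_sub_le s hs
    have ht' := H.abs_sub_le t ht
    rw [← he] at ht'
    have hpos : 0 < w (h s) := by
      refine lt_of_le_of_ne (H.nonneg _) fun h0 => ?_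
      rw [← h0, zero_div, abs_nonpos_iff] at hs' ht'
      linarith
    have := strictMonoOn_gapMap hpos (hF.weight_pos H (H.mapsTo _ hs) hpos)
      (abs_le.1 hs') (abs_le.1 ht') (by linarith)
    simp only [blowup, ← he, mul_add, ← mul_assoc, hF.sign_sq, one_mul]
    linarith
  · have h3 := hF.strictMono _ (H.mapsTo _ hs) _ (H.mapsTo _ ht) hlt
    rw [← h1.2, ← h2.2] at h3
    -- For points of different gaps: an inversion of order upstairs would pass to `F` through the
    -- monotone `h`.
    by_contra! hle
    rcases hF.sign with rfl | rfl
    · have := H.monotoneOn h2.1 h1.1 (by linarith)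
      linarith
    · have := H.monotoneOn h1.1 h2.1 (by linarith)
      linarith

lemma GapHomeo.blowup_surjOn (hF : GapHomeo D w σ F) (H : GapData D w c h) :
    SurjOn (blowup w c h σ F) D D := by
  intro s hs
  obtain ⟨x, hx, hxs⟩ := hF.surjOn (H.mapsTo s hs)
  have hs' := H.abs_sub_le s hs
  have h1 := abs_gapMap_le (H.nonneg (h s)) (H.nonneg x) hs'
  -- The preimage is given by the inverse gap map, placed in the gap at the preimage `x` of `h s`.
  obtain ⟨htD, hht⟩ := H.of_abs_sub_le x hx
    (c x + σ * gapMap (w (h s)) (w x) (s - c (h s))) (by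
      rwa [add_sub_cancel_left, abs_sign_mul hF.sign])
  refine ⟨_, htD, ?_⟩
  rw [blowup, hht, add_sub_cancel_left, hxs, sign_mul_gapMap hF.sign (H.nonneg _) h1, ← mul_assoc,
    hF.sign_sq, one_mul]
  have hw := hF.weight_eq_zero x hx
  rw [hxs] at hw
  rcases (H.nonneg (h s)).eq_or_lt with h4 | h4
  · rw [← h4, zero_div, abs_nonpos_iff] at hs'
    rw [hw.1 h4.symm, ← h4, gapMap_zero_left]
    linarith
  · rw [gapMap_gapMap h4 (lt_of_le_of_ne (H.nonneg _) fun h5 => h4.ne' (hw.2 h5.symm)),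
      gapMap_self (H.nonneg _) hs']
    ring

/-- The complement of the open gaps is mapped into itself, because end points of gaps go to end
points and degenerate gaps to degenerate gaps; thus its image is null. -/
lemma GapHomeo.blowup_null (hF : GapHomeo D w σ F) (H : GapData D w c h) {t : ℝ} (ht : t ∈ D)
    (h1 : w (h t) / 2 ≤ |t - c (h t)|) :
    w (h (blowup w c h σ F t)) / 2 ≤
      |blowup w c h σ F t - c (h (blowup w c h σ F t))| := by
  rw [(H.blowup_mem hF.sign ht (hF.mapsTo _ (H.mapsTo _ ht))).2, blowup, add_sub_cancel_left,
    abs_sign_mul hF.sign]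
  rcases (H.nonneg (h t)).eq_or_lt with h4 | h4
  · rw [(hF.weight_eq_zero _ (H.mapsTo _ ht)).2 h4.symm]
    simp
  · have hb := hF.weight_pos H (H.mapsTo _ ht) h4
    have h2 := le_antisymm (H.abs_sub_le t ht) h1
    rcases (abs_eq (by positivity)).1 h2 with h3 | h3
    · rw [h3, gapMap_half h4 hb, abs_of_pos (by positivity)]
    · rw [h3, gapMap_neg_half h4 hb, abs_neg, abs_of_pos (by positivity)]

lemma GapData.isOpen_gaps (H : GapData D w c h) :
    IsOpen {t | t ∈ D ∧ |t - c (h t)| < w (h t) / 2} := by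
  have : {t | t ∈ D ∧ |t - c (h t)| < w (h t) / 2} = ⋃ x ∈ D, {t | |t - c x| < w x / 2} := by
    ext t
    simp only [mem_ofPred_eq, mem_iUnion, exists_prop]
    constructor
    · rintro ⟨ht, h1⟩
      exact ⟨h t, H.mapsTo t ht, h1⟩
    · rintro ⟨x, hx, h1⟩
      obtain ⟨h2, rfl⟩ := H.of_abs_sub_le x hx t h1.le
      exact ⟨h2, h1⟩
  rw [this]
  exact isOpen_biUnion fun x _ => isOpen_lt (by fun_prop) continuous_const

lemma GapHomeo.hasDerivAt_blowup (hF : GapHomeo D w σ F) (H : GapData D w c h) {t : ℝ} (ht : t ∈ D)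
    (h1 : |t - c (h t)| < w (h t) / 2) :
    HasDerivAt (blowup w c h σ F) (σ * blowupDeriv w c h F t) t := by
  have ha : 0 < w (h t) := by
    have := abs_nonneg (t - c (h t)); linarith
  have hb := hF.weight_pos H (H.mapsTo _ ht) ha
  have hev : ∀ᶠ s in 𝓝 t, h s = h t := by
    have : ∀ᶠ s in 𝓝 t, |s - c (h t)| < w (h t) / 2 :=
      (isOpen_lt (by fun_prop) continuous_const).mem_nhds h1
    filter_upwards [this] with s hs
    exact (H.of_abs_sub_le _ (H.mapsTo _ ht) s hs.le).2
  have hd := (((hasDerivAt_gapMap ha hb h1.le).comp_sub_const t (c (h t))).const_mul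
    σ).const_add (c (F (h t)))
  rw [blowupDeriv, if_neg ha.ne']
  refine hd.congr_of_eventuallyEq ?_
  filter_upwards [hev] with s hs
  simp only [blowup, hs]

lemma GapHomeo.blowupDeriv_pos (hF : GapHomeo D w σ F) (H : GapData D w c h) {t : ℝ} (ht : t ∈ D) :
    0 < blowupDeriv w c h F t := by
  rw [blowupDeriv]
  split_ifs with h0
  · exact one_pos
  · have ha := lt_of_le_of_ne (H.nonneg _) (Ne.symm h0)
    exact gapDeriv_pos ha (hF.weight_pos H (H.mapsTo _ ht) ha) _

lemma abs_sq_sub_one_lt {r ε : ℝ} (h : |r - 1| < min 1 (ε / 3)) : |r ^ 2 - 1| < ε := by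
  have h1 := abs_lt.1 (h.trans_le (min_le_left _ _))
  have h2 := h.trans_le (min_le_right _ _)
  have e : r ^ 2 - 1 = (r - 1) * (r + 1) := by ring
  have h3 : |r + 1| ≤ 3 := abs_le.2 ⟨by linarith, by linarith⟩
  rw [e, abs_mul]
  nlinarith [abs_nonneg (r - 1)]

/-- Near a given point, the derivative is uniformly approximated by 1 plus the bumps of the finitely
many gaps whose length ratio is far from 1. The bumps are continuous since the gap maps have
derivative 1 at the ends. -/
lemma GapHomeo.continuousOn_blowupDeriv (hF : GapHomeo D w σ F) (H : GapData D w c h) :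
    ContinuousOn (blowupDeriv w c h F) D := by
  refine continuousOn_of_locally_uniform_approx_of_continuousWithinAt fun t₀ ht₀ u hu => ?_
  obtain ⟨ε, hε, hεu⟩ := Metric.mem_uniformity_dist.1 hu
  obtain ⟨C, hC⟩ := H.exists_bound
  -- A point within 1 of `t₀` lies in a gap whose index is within `C` of it, hence the enlarged
  -- window. The threshold `min 1 (ε / 3)` makes the squared ratio `ε`-close to 1.
  have hfin := hF.finite (min 1 (ε / 3)) (by positivity) (t₀ - 1 - C) (t₀ + 1 + C)
  set B := {x | x ∈ D ∧ x ∈ Icc (t₀ - 1 - C) (t₀ + 1 + C) ∧ w x ≠ 0 ∧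
    min 1 (ε / 3) ≤ |w (F x) / w x - 1|} with hB
  refine ⟨D ∩ Metric.ball t₀ 1, inter_mem_nhdsWithin _ (Metric.ball_mem_nhds _ one_pos),
    fun s => 1 + ∑ x ∈ hfin.toFinset, gapBump (w x) (w (F x)) (s - c x), ?_, ?_⟩
  · refine Continuous.continuousWithinAt (continuous_const.add (continuous_finsetSum _ ?_))
    intro x hx
    obtain ⟨hxD, -, hx0, -⟩ := hfin.mem_toFinset.1 hx
    have ha := lt_of_le_of_ne (H.nonneg x) hx0.symm
    exact (continuous_gapBump ha (hF.weight_pos H hxD ha)).comp (by fun_prop)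
  · rintro s ⟨hsD, hs⟩
    refine hεu ?_
    have hzero : ∀ x ∈ hfin.toFinset, x ≠ h s → gapBump (w x) (w (F x)) (s - c x) = 0 := by
      intro x hx hne
      obtain ⟨hxD, -, hx0, -⟩ := hfin.mem_toFinset.1 hx
      have ha := lt_of_le_of_ne (H.nonneg x) hx0.symm
      refine gapBump_of_lt ha (hF.weight_pos H hxD ha) ?_
      by_contra! hcon
      exact hne (H.of_abs_sub_le x hxD s hcon).2.symm
    have hs' := H.abs_sub_le s hsD
    rw [Real.dist_eq]
    beta_reduce
    by_cases hm : h s ∈ hfin.toFinset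
    · have hw : w (h s) ≠ 0 := (hfin.mem_toFinset.1 hm).2.2.1
      rw [Finset.sum_eq_single_of_mem _ hm hzero, gapBump_of_le hs', blowupDeriv, if_neg hw]
      simpa using hε
    · rw [Finset.sum_eq_zero fun x hx => hzero x hx fun e => hm (e ▸ hx), add_zero, blowupDeriv]
      split_ifs with hw
      · simpa using hε
      · have ha := lt_of_le_of_ne (H.nonneg (h s)) (Ne.symm hw)
        refine (abs_gapDeriv_sub_one_le ha (hF.weight_pos H (H.mapsTo _ hsD) ha) _).trans_lt ?_
        refine abs_sq_sub_one_lt ?_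
        by_contra! hcon
        refine hm (hfin.mem_toFinset.2 ⟨H.mapsTo _ hsD, ?_, hw, hcon⟩)
        have h1 := abs_le.1 (hC s hsD)
        have h2 := abs_lt.1 (by simpa [Real.dist_eq] using hs : |s - t₀| < 1)
        exact ⟨by linarith, by linarith⟩

lemma GapHomeo.blowup_image_Icc (hF : GapHomeo D w σ F) (H : GapData D w c h) {a b : ℝ}
    (ha : a ∈ D) (hb : b ∈ D) (hab : a ≤ b) :
    blowup w c h σ F '' Icc a b = uIcc (blowup w c h σ F a) (blowup w c h σ F b) := by
  have hmono := hF.blowup_strictMono H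
  have hsub : Icc a b ⊆ D := H.ordConnected.out ha hb
  have hmem : ∀ t ∈ D, blowup w c h σ F t ∈ D := fun t ht =>
    (H.blowup_mem hF.sign ht (hF.mapsTo _ (H.mapsTo _ ht))).1
  ext s
  constructor
  · rintro ⟨t, ht, rfl⟩
    have h1 := hmono.monotoneOn ha (hsub ht) ht.1
    have h2 := hmono.monotoneOn (hsub ht) hb ht.2
    rw [mem_uIcc]
    rcases hF.sign with rfl | rfl
    · left; constructor <;> linarith
    · right; constructor <;> linarith
  · intro hs
    have hsD : s ∈ D := H.ordConnected.uIcc_subset (hmem a ha) (hmem b hb) hs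
    obtain ⟨t, ht, rfl⟩ := hF.blowup_surjOn H hsD
    have h3 := hmono.monotoneOn ha hb hab
    refine ⟨t, ⟨(hmono.le_iff_le ha ht).1 ?_, (hmono.le_iff_le ht hb).1 ?_⟩, rfl⟩ <;>
    · rw [mem_uIcc] at hs
      rcases hF.sign with rfl | rfl <;> rcases hs with hs | hs <;> linarith

/-- The blow-up is the restriction of a map of class `C^1`. -/
theorem GapHomeo.exists_contDiff (hF : GapHomeo D w σ F) (H : GapData D w c h) :
    ∃ f : ℝ → ℝ, ContDiff ℝ 1 f ∧ EqOn f (blowup w c h σ F) D := by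
  rcases D.eq_empty_or_nonempty with rfl | ⟨t₀, ht₀⟩
  · exact ⟨fun _ => 0, contDiff_const, by simp⟩
  -- Tietze extension of the derivative to the whole line.
  obtain ⟨q, hq⟩ := ContinuousMap.exists_restrict_eq H.isClosed
    ⟨D.domRestrict (blowupDeriv w c h F), (hF.continuousOn_blowupDeriv H).domRestrict⟩
  have hqD : ∀ t ∈ D, q t = blowupDeriv w c h F t := fun t ht =>
    congrArg (fun f : C(D, ℝ) => f ⟨t, ht⟩) hq
  have hqpos : ∀ t ∈ D, 0 < q t := fun t ht => by
    rw [hqD t ht]; exact hF.blowupDeriv_pos H ht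
  set f := blowup w c h σ F with hf
  have hmono := hF.blowup_strictMono H
  have hinj : InjOn f D := fun s hs t ht hst => hmono.injOn hs ht (by simp only [← hf, hst])
  have key : ∀ a ∈ D, ∀ b ∈ D, a ≤ b → f b - f a = σ * ∫ t in a..b, q t := by
    intro a ha b hb hab
    have hsub : Icc a b ⊆ D := H.ordConnected.out ha hb
    set U := {t | t ∈ D ∧ |t - c (h t)| < w (h t) / 2} with hU
    set K := {t | t ∈ D ∧ w (h t) / 2 ≤ |t - c (h t)|} with hK
    have hUo : IsOpen U := H.isOpen_gaps
    have hsplit : Icc a b ⊆ (U ∩ Icc a b) ∪ K := by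
      intro t ht
      rcases lt_or_ge |t - c (h t)| (w (h t) / 2) with h1 | h1
      · exact Or.inl ⟨⟨hsub ht, h1⟩, ht⟩
      · exact Or.inr ⟨hsub ht, h1⟩
    have himK : f '' K ⊆ K := by
      rintro _ ⟨t, ht, rfl⟩
      exact ⟨(H.blowup_mem hF.sign ht.1 (hF.mapsTo _ (H.mapsTo _ ht.1))).1,
        hF.blowup_null H ht.1 ht.2⟩
    -- Discarding the null complement `K` loses no length of the image, as `K` is mapped into
    -- itself.
    have e1 : MeasureTheory.volume (f '' (U ∩ Icc a b)) = MeasureTheory.volume (f '' Icc a b) := by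
      refine le_antisymm (MeasureTheory.measure_mono (image_mono inter_subset_right)) ?_
      calc _ ≤ MeasureTheory.volume (f '' (U ∩ Icc a b) ∪ K) :=
            MeasureTheory.measure_mono ((image_mono hsplit).trans (by
              rw [image_union]; exact union_subset_union_right _ himK))
        _ ≤ _ := MeasureTheory.measure_union_le _ _
        _ = _ := by rw [show MeasureTheory.volume K = 0 from H.null, add_zero]
    -- Change of variables on the open gaps, where the derivative is known; `e1` and `e3` then pass
    -- to all of `[a, b]`.
    have e2 := MeasureTheory.lintegral_image_eq_lintegral_abs_deriv_mul
      (s := U ∩ Icc a b) (hUo.measurableSet.inter measurableSet_Icc) (f := f) (f' := fun t => σ * q t)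
      (fun t ht => by
        rw [hqD t ht.1.1]
        exact (hF.hasDerivAt_blowup H ht.1.1 ht.1.2).hasDerivWithinAt)
      (hinj.mono fun t ht => ht.1.1) (fun _ => 1)
    have e3 : ∫⁻ t in U ∩ Icc a b, ENNReal.ofReal |σ * q t| * 1 =
        ∫⁻ t in Icc a b, ENNReal.ofReal (q t) := by
      have hae : (U ∩ Icc a b : Set ℝ) =ᵐ[MeasureTheory.volume] Icc a b := by
        refine Filter.EventuallyLE.antisymm (LE.le.eventuallyLE inter_subset_right) ?_
        have : ∀ᵐ t, t ∉ K := MeasureTheory.measure_eq_zero_iff_ae_notMem.1 H.null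
        filter_upwards [this] with t ht htI
        exact (hsplit htI).resolve_right ht
      rw [MeasureTheory.setLIntegral_congr hae]
      refine MeasureTheory.setLIntegral_congr_fun measurableSet_Icc fun t ht => ?_
      simp only [mul_one]
      rw [abs_sign_mul hF.sign, abs_of_pos (hqpos t (hsub ht))]
    rw [e3, MeasureTheory.setLIntegral_one, e1, hF.blowup_image_Icc H ha hb hab,
      Real.volume_interval, ← MeasureTheory.ofReal_integral_eq_lintegral_ofReal
        q.continuous.integrableOn_Icc
        ((MeasureTheory.ae_restrict_iff' measurableSet_Icc).2 (.of_forall fun t ht =>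
          (hqpos t (hsub ht)).le)),
      MeasureTheory.integral_Icc_eq_integral_Ioc, ← intervalIntegral.integral_of_le hab] at e2
    have h4 : 0 ≤ ∫ t in a..b, q t :=
      intervalIntegral.integral_nonneg hab fun t ht => (hqpos t (hsub ht)).le
    rw [ENNReal.ofReal_eq_ofReal_iff (abs_nonneg _) h4] at e2
    have h5 := hmono.monotoneOn ha hb hab
    simp only [← hf] at e2 h5
    rw [← e2]
    rcases hF.sign with rfl | rfl
    · rw [abs_of_nonneg (by linarith)]; ring
    · rw [abs_of_nonpos (by linarith)]; ring
  refine ⟨fun t => f t₀ + σ * ∫ s in t₀..t, q s, ?_, ?_⟩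
  · have hd : ∀ t, HasDerivAt (fun t => f t₀ + σ * ∫ s in t₀..t, q s) (σ * q t) t := fun t =>
      ((intervalIntegral.integral_hasDerivAt_right (q.continuous.intervalIntegrable _ _)
        q.continuous.stronglyMeasurable.stronglyMeasurableAtFilter
        q.continuous.continuousAt).const_mul σ).const_add (f t₀)
    rw [contDiff_one_iff_deriv]
    refine ⟨fun t => (hd t).differentiableAt, ?_⟩
    rw [show deriv (fun t => f t₀ + σ * ∫ s in t₀..t, q s) = fun t => σ * q t from
      funext fun t => (hd t).deriv]
    exact continuous_const.mul q.continuous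
  · intro t ht
    simp only
    rcases le_total t₀ t with hle | hle
    · rw [← key t₀ ht₀ t ht hle]; ring
    · rw [intervalIntegral.integral_symm, mul_neg, ← key t ht t₀ ht₀ hle]; ring

end Blowup

/-! ### Gaps from an atomic measure of full support -/

section GapDataConstruction

/-- The mass of `Iio x` for the atomic measure with weights `v`. -/
noncomputable def lowerMass (v : ℝ → ℝ) (x : ℝ) : ℝ := ∑' z, (Iio x).indicator v z

/-- The center of the gap at `x`. -/
noncomputable def gapCenter (v : ℝ → ℝ) (x : ℝ) : ℝ := lowerMass v x + v x / 2

/-- The map which collapses the gaps. -/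
noncomputable def collapse (v : ℝ → ℝ) (t : ℝ) : ℝ := sSup {x | x ∈ Icc (0 : ℝ) 1 ∧ lowerMass v x ≤ t}

/-- A probability measure on `[0, 1]` which is purely atomic and of full support. -/
structure AtomicWeight (v : ℝ → ℝ) : Prop where
  nonneg : ∀ x, 0 ≤ v x
  support : ∀ x, v x ≠ 0 → x ∈ Icc (0 : ℝ) 1
  hasSum : HasSum v 1
  dense : ∀ x ∈ Icc (0 : ℝ) 1, ∀ y ∈ Icc (0 : ℝ) 1, x < y → ∃ z ∈ Ioo x y, v z ≠ 0

variable {v : ℝ → ℝ}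

lemma lowerMass_add (hv : Summable v) (x : ℝ) :
    lowerMass v x + v x = ∑' z, (Iic x).indicator v z := by
  have h1 : HasSum (({x} : Set ℝ).indicator v) (v x) := by
    have := hasSum_ite_eq x (v x)
    refine this.congr_fun ?_
    intro z
    by_cases h : z = x <;> simp [h]
  have h2 := ((hv.indicator (Iio x)).hasSum.add h1).tsum_eq
  rw [lowerMass, ← h2]
  congr 1
  funext z
  rw [← Iio_union_right, indicator_union_of_disjoint (by simp)]

lemma abs_sub_gapCenter_le_iff {x t : ℝ} :
    |t - gapCenter v x| ≤ v x / 2 ↔ lowerMass v x ≤ t ∧ t ≤ lowerMass v x + v x := by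
  rw [abs_le, gapCenter]
  constructor <;> rintro ⟨h1, h2⟩ <;> constructor <;> linarith

namespace AtomicWeight

variable (hv : AtomicWeight v)
include hv

/-- There is an atom strictly between the two points. Hence the closed gaps are disjoint and ordered
like their indices. -/
lemma lowerMass_add_lt {x y : ℝ} (hx : x ∈ Icc (0 : ℝ) 1) (hy : y ∈ Icc (0 : ℝ) 1) (hxy : x < y) :
    lowerMass v x + v x < lowerMass v y := by
  rw [lowerMass_add hv.hasSum.summable]
  obtain ⟨z, hz, hz0⟩ := hv.dense x hx y hy hxy
  refine Summable.tsum_lt_tsum (i := z) ?_ ?_ (hv.hasSum.summable.indicator _)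
    (hv.hasSum.summable.indicator _)
  · exact indicator_le_indicator_of_subset (Iic_subset_Iio.2 hxy) hv.nonneg
  · rw [indicator_of_notMem (by simpa using hz.1), indicator_of_mem (by simpa using hz.2)]
    exact lt_of_le_of_ne (hv.nonneg z) hz0.symm

lemma lowerMass_zero : lowerMass v 0 = 0 := by
  rw [lowerMass, ← tsum_zero (β := ℝ)]
  congr 1
  funext z
  by_cases hz : z < 0
  · rw [indicator_of_mem (by simpa using hz)]
    by_contra h
    exact absurd (hv.support z h).1 (not_le.2 hz)
  · rw [indicator_of_notMem (by simpa using hz)]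

lemma lowerMass_one_add : lowerMass v 1 + v 1 = 1 := by
  rw [lowerMass_add hv.hasSum.summable]
  refine Eq.trans ?_ hv.hasSum.tsum_eq
  congr 1
  funext z
  by_cases hz : z ≤ 1
  · rw [indicator_of_mem (by simpa using hz)]
  · rw [indicator_of_notMem (by simpa using hz)]
    by_contra h
    exact hz (hv.support z (Ne.symm h)).2

lemma lowerMass_nonneg (x : ℝ) : 0 ≤ lowerMass v x :=
  tsum_nonneg fun _ => indicator_nonneg (fun _ _ => hv.nonneg _) _

lemma lowerMass_add_le_one (x : ℝ) : lowerMass v x + v x ≤ 1 := by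
  rw [lowerMass_add hv.hasSum.summable, ← hv.hasSum.tsum_eq]
  exact Summable.tsum_le_tsum (indicator_le_self' fun _ _ => hv.nonneg _)
    (hv.hasSum.summable.indicator _) hv.hasSum.summable

lemma tendsto_lowerMass_left (x : ℝ) : Tendsto (lowerMass v) (𝓝[<] x) (𝓝 (lowerMass v x)) := by
  unfold lowerMass
  refine tendsto_tsum_of_dominated_convergence hv.hasSum.summable (fun z => ?_)
    (.of_forall fun y z => ?_)
  · refine tendsto_const_nhds.congr' ?_
    by_cases hz : z < x
    · filter_upwards [Ioo_mem_nhdsLT hz] with y hy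
      rw [indicator_of_mem (by simpa using hz), indicator_of_mem (by simpa using hy.1)]
    · filter_upwards [self_mem_nhdsWithin] with y (hy : y < x)
      rw [indicator_of_notMem (by simpa using hz), indicator_of_notMem]
      simp only [mem_Iio, not_lt] at hz ⊢
      linarith
  · exact (norm_indicator_le_norm_self _ _).trans_eq (Real.norm_of_nonneg (hv.nonneg z))

lemma tendsto_lowerMass_right (x : ℝ) :
    Tendsto (lowerMass v) (𝓝[>] x) (𝓝 (lowerMass v x + v x)) := by
  rw [lowerMass_add hv.hasSum.summable]
  unfold lowerMass
  refine tendsto_tsum_of_dominated_convergence hv.hasSum.summable (fun z => ?_)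
    (.of_forall fun y z => ?_)
  · refine tendsto_const_nhds.congr' ?_
    by_cases hz : z ≤ x
    · filter_upwards [self_mem_nhdsWithin] with y (hy : x < y)
      rw [indicator_of_mem (by simpa using hz), indicator_of_mem]
      simp only [mem_Iio]
      linarith
    · filter_upwards [Ioo_mem_nhdsGT (not_le.1 hz)] with y hy
      rw [indicator_of_notMem (by simpa using hz), indicator_of_notMem (by simpa using hy.2.le)]
  · exact (norm_indicator_le_norm_self _ _).trans_eq (Real.norm_of_nonneg (hv.nonneg z))

/-- Points below the supremum satisfy the defining inequality and points above it fail; the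
one-sided limits of the mass function at the supremum are the two ends of its gap. -/
lemma collapse_spec {t : ℝ} (ht : t ∈ Icc (0 : ℝ) 1) :
    collapse v t ∈ Icc (0 : ℝ) 1 ∧ lowerMass v (collapse v t) ≤ t ∧
      t ≤ lowerMass v (collapse v t) + v (collapse v t) := by
  set A := {x | x ∈ Icc (0 : ℝ) 1 ∧ lowerMass v x ≤ t} with hA
  have h0 : (0 : ℝ) ∈ A := ⟨⟨le_rfl, zero_le_one⟩, by rw [hv.lowerMass_zero]; exact ht.1⟩
  have hbdd : BddAbove A := ⟨1, fun x hx => hx.1.2⟩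
  have hs : collapse v t = sSup A := rfl
  set x := collapse v t
  have hx0 : 0 ≤ x := hs ▸ le_csSup hbdd h0
  have hx1 : x ≤ 1 := hs ▸ csSup_le ⟨0, h0⟩ fun y hy => hy.1.2
  refine ⟨⟨hx0, hx1⟩, ?_, ?_⟩
  · by_cases hxA : x ∈ A
    · exact hxA.2
    refine le_of_tendsto (hv.tendsto_lowerMass_left x) ?_
    have hxpos : 0 < x := lt_of_le_of_ne hx0 fun h => hxA (h ▸ h0)
    filter_upwards [Ioo_mem_nhdsLT hxpos] with y hy
    obtain ⟨z, hz, hyz⟩ := exists_lt_of_lt_csSup ⟨0, h0⟩ (hs ▸ hy.2)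
    have := hv.lowerMass_add_lt ⟨hy.1.le, hy.2.le.trans hx1⟩ hz.1 hyz
    linarith [hv.nonneg y, hz.2]
  · rcases hx1.eq_or_lt with h1 | h1
    · rw [h1, hv.lowerMass_one_add]; exact ht.2
    · refine ge_of_tendsto (hv.tendsto_lowerMass_right x) ?_
      filter_upwards [Ioo_mem_nhdsGT h1] with y hy
      by_contra! hcon
      have : y ≤ x := hs ▸ le_csSup hbdd ⟨⟨hx0.trans hy.1.le, hy.2.le⟩, hcon.le⟩
      exact absurd hy.1 (not_lt.2 this)

lemma collapse_eq {x t : ℝ} (hx : x ∈ Icc (0 : ℝ) 1) (h1 : lowerMass v x ≤ t)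
    (h2 : t ≤ lowerMass v x + v x) : t ∈ Icc (0 : ℝ) 1 ∧ collapse v t = x := by
  have ht : t ∈ Icc (0 : ℝ) 1 :=
    ⟨(hv.lowerMass_nonneg x).trans h1, h2.trans (hv.lowerMass_add_le_one x)⟩
  obtain ⟨h3, h4, h5⟩ := hv.collapse_spec ht
  refine ⟨ht, ?_⟩
  rcases lt_trichotomy (collapse v t) x with h | h | h
  · linarith [hv.lowerMass_add_lt h3 hx h]
  · exact h
  · linarith [hv.lowerMass_add_lt hx h3 h]

/-- The gaps are disjoint and the measure is purely atomic, so their lengths add up to its total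
mass. -/
lemma volume_gaps :
    MeasureTheory.volume (⋃ x ∈ Function.support v,
      Ioo (lowerMass v x) (lowerMass v x + v x)) = 1 := by
  rw [MeasureTheory.measure_biUnion hv.hasSum.summable.countable_support]
  · simp only [Real.volume_Ioo, add_sub_cancel_left]
    rw [← ENNReal.ofReal_tsum_of_nonneg (fun x => hv.nonneg _)
      (hv.hasSum.summable.comp_injective Subtype.val_injective), tsum_subtype_support,
      hv.hasSum.tsum_eq, ENNReal.ofReal_one]
  · intro x hx y hy hne
    rw [Function.onFun, Set.disjoint_left]
    intro t ht1 ht2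
    refine hne ?_
    rw [← (hv.collapse_eq (hv.support x hx) ht1.1.le ht1.2.le).2,
      ← (hv.collapse_eq (hv.support y hy) ht2.1.le ht2.2.le).2]
  · exact fun x _ => measurableSet_Ioo

theorem gapData : GapData (Icc 0 1) v (gapCenter v) (collapse v) where
  isClosed := isClosed_Icc
  ordConnected := ordConnected_Icc
  nonneg := hv.nonneg
  mapsTo t ht := (hv.collapse_spec ht).1
  abs_sub_le t ht := abs_sub_gapCenter_le_iff.2 (hv.collapse_spec ht).2
  of_abs_sub_le x hx t h := by
    obtain ⟨h1, h2⟩ := abs_sub_gapCenter_le_iff.1 h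
    exact hv.collapse_eq hx h1 h2
  monotoneOn s hs t ht hst := by
    obtain ⟨h3, h4, h5⟩ := hv.collapse_spec hs
    obtain ⟨h6, h7, h8⟩ := hv.collapse_spec ht
    by_contra! hlt
    linarith [hv.lowerMass_add_lt h6 h3 hlt]
  exists_bound := by
    refine ⟨1, fun t ht => ?_⟩
    obtain ⟨h3, -⟩ := hv.collapse_spec ht
    exact abs_le.2 ⟨by linarith [h3.1, ht.2], by linarith [h3.2, ht.1]⟩
  null := by
    set U := ⋃ x ∈ Function.support v, Ioo (lowerMass v x) (lowerMass v x + v x) with hU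
    have hUm : MeasurableSet U :=
      MeasurableSet.biUnion hv.hasSum.summable.countable_support fun x _ => measurableSet_Ioo
    have hUI : U ⊆ Icc 0 1 := by
      refine iUnion₂_subset fun x hx t ht => ?_
      exact (hv.collapse_eq (hv.support x hx) ht.1.le ht.2.le).1
    have hd : MeasureTheory.volume (Icc (0 : ℝ) 1 \ U) = 0 := by
      rw [MeasureTheory.measure_sdiff hUI hUm.nullMeasurableSet (by rw [hv.volume_gaps]; simp),
        hv.volume_gaps]
      simp
    refine MeasureTheory.measure_mono_null ?_ hd
    rintro t ⟨ht, h1⟩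
    refine ⟨ht, fun htU => ?_⟩
    simp only [hU, mem_iUnion, exists_prop] at htU
    obtain ⟨x, hx, hxt⟩ := htU
    rw [(hv.collapse_eq (hv.support x hx) hxt.1.le hxt.2.le).2] at h1
    refine absurd h1 (not_le.2 ?_)
    rw [abs_lt, gapCenter]
    constructor <;> linarith [hxt.1, hxt.2]

end AtomicWeight

/-- A gap structure on `[0, 1]` extends periodically to the line if there is no gap at `1`. -/
theorem GapData.periodic {c h : ℝ → ℝ} (H : GapData (Icc 0 1) v c h) (hv1 : v 1 = 0)
    (hc1 : c 1 = 1) :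
    GapData univ (fun x => v (Int.fract x)) (fun x => ⌊x⌋ + c (Int.fract x))
      (fun t => ⌊t⌋ + h (Int.fract t)) := by
  have hI : ∀ t : ℝ, Int.fract t ∈ Icc (0 : ℝ) 1 := fun t =>
    ⟨Int.fract_nonneg t, (Int.fract_lt_one t).le⟩
  have h11 : h 1 = 1 := (H.of_abs_sub_le 1 ⟨zero_le_one, le_rfl⟩ 1 (by simp [hc1, hv1])).2
  -- The gap at 1 is the single point 1, which is not a fractional part; so each period of the line
  -- is preserved.
  have hlt : ∀ t : ℝ, h (Int.fract t) < 1 := by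
    intro t
    refine lt_of_le_of_ne (H.mapsTo _ (hI t)).2 fun he => ?_
    have := H.abs_sub_le _ (hI t)
    rw [he, hv1, hc1, zero_div, abs_nonpos_iff] at this
    linarith [Int.fract_lt_one t]
  have hfl : ∀ t : ℝ, ⌊(⌊t⌋ : ℝ) + h (Int.fract t)⌋ = ⌊t⌋ := by
    intro t
    rw [Int.floor_intCast_add, Int.floor_eq_zero_iff.2 ⟨(H.mapsTo _ (hI t)).1, hlt t⟩, add_zero]
  have hfr : ∀ t : ℝ, Int.fract ((⌊t⌋ : ℝ) + h (Int.fract t)) = h (Int.fract t) := by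
    intro t
    rw [Int.fract_intCast_add, Int.fract_eq_self.2 ⟨(H.mapsTo _ (hI t)).1, hlt t⟩]
  have habs : ∀ t : ℝ, t - ((⌊(⌊t⌋ : ℝ) + h (Int.fract t)⌋ : ℝ) +
      c (Int.fract ((⌊t⌋ : ℝ) + h (Int.fract t)))) = Int.fract t - c (h (Int.fract t)) := by
    intro t
    rw [hfl, hfr, Int.fract]; ring
  refine ⟨isClosed_univ, ordConnected_univ, fun x => H.nonneg _, fun _ _ => mem_univ _,
    fun t _ => ?_, fun x _ t ht => ⟨mem_univ _, ?_⟩, ?_, ⟨1, fun t _ => ?_⟩, ?_⟩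
  · rw [habs, hfr]
    exact H.abs_sub_le _ (hI t)
  · obtain ⟨h1, h2⟩ := H.of_abs_sub_le _ (hI x) (t - ⌊x⌋) (by
      rw [sub_sub]; exact ht)
    have h3 : t - ⌊x⌋ < 1 := by
      refine lt_of_le_of_ne h1.2 fun he => ?_
      rw [he, h11] at h2
      linarith [Int.fract_lt_one x]
    have h4 : ⌊t⌋ = ⌊x⌋ := Int.floor_eq_iff.2 ⟨by linarith [h1.1], by linarith⟩
    have h5 : Int.fract t = t - ⌊x⌋ := by rw [Int.fract, h4]
    simp only [h4, h5, h2, Int.floor_add_fract]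
  · intro s _ t _ hst
    rcases (Int.floor_mono hst).eq_or_lt with he | hl
    · simp only [he]
      have : Int.fract s ≤ Int.fract t := by
        rw [Int.fract, Int.fract, he]; linarith
      gcongr
      exact H.monotoneOn (hI s) (hI t) this
    · have : (⌊s⌋ : ℝ) + 1 ≤ ⌊t⌋ := by exact_mod_cast hl
      have h1 := hlt s
      have h2 := (H.mapsTo _ (hI t)).1
      simp only
      linarith
  · have h1 := H.mapsTo _ (hI t)
    have h2 := hI t
    have h3 := Int.floor_add_fract t
    exact abs_le.2 ⟨by linarith [h1.1, h2.2], by linarith [h1.2, h2.1]⟩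
  · refine MeasureTheory.measure_mono_null (t := ⋃ n : ℤ, (fun t : ℝ => t + (-n)) ⁻¹'
      {t | t ∈ Icc (0 : ℝ) 1 ∧ v (h t) / 2 ≤ |t - c (h t)|}) ?_ ?_
    · rintro t ⟨-, ht⟩
      rw [habs, hfr] at ht
      refine mem_iUnion.2 ⟨⌊t⌋, ?_⟩
      have : t + (-⌊t⌋) = Int.fract t := by rw [Int.fract]; ring
      simp only [mem_preimage, this]
      exact ⟨hI t, ht⟩
    · rw [MeasureTheory.measure_iUnion_null_iff]
      intro n
      rw [MeasureTheory.measure_preimage_add_right]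
      exact H.null

end GapDataConstruction

/-! ### From compatible maps to an action, and transport by diffeomorphisms -/

section Assembly

/-- Preimages of connected sets under a closed continuous map with connected fibres. -/
lemma IsClosedMap.isPreconnected_preimage_of_fibers {α β : Type*} [TopologicalSpace α]
    [TopologicalSpace β] {f : α → β} (hf : IsClosedMap f) (hc : Continuous f)
    (hfib : ∀ y, IsConnected (f ⁻¹' {y})) {J : Set β} (hJ : IsPreconnected J) :
    IsPreconnected (f ⁻¹' J) := by
  rcases J.eq_empty_or_nonempty with rfl | hne
  · simpa using isPreconnected_empty
  have hsurj : Function.Surjective f := fun y => (hfib y).nonempty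
  -- A closed surjection stays a quotient map over `J`, and a quotient map with connected fibres
  -- pulls connected sets back to connected sets.
  have hq : IsQuotientMap (J.restrictPreimage f) :=
    (hf.restrictPreimage J).isQuotientMap hc.restrictPreimage
      (Set.restrictPreimage_surjective J hsurj)
  have himage : ∀ s : Set J, (Subtype.val '' (J.restrictPreimage f ⁻¹' s) : Set α) =
      f ⁻¹' (Subtype.val '' s) := by
    intro s
    ext x
    simp only [mem_image, mem_preimage, Subtype.exists, exists_and_right, exists_eq_right]
    exact Iff.rfl
  have h1 : ∀ y : J, IsConnected (J.restrictPreimage f ⁻¹' {y}) := by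
    intro y
    have e := himage {y}
    rw [image_singleton] at e
    refine ⟨?_, ?_⟩
    · have := (hfib y).nonempty
      rw [← e] at this
      exact this.of_image
    · rw [← IsInducing.subtypeVal.isPreconnected_image, e]
      exact (hfib y).isPreconnected
  have hJc : IsConnected (univ : Set J) := by
    have : ConnectedSpace J := isConnected_iff_connectedSpace.1 ⟨hne, hJ⟩
    exact isConnected_univ
  have h2 := hq.isCoinducing.isConnected_preimage_of_isClosed h1 isClosed_univ hJc
  have e := himage univ
  rw [image_univ, Subtype.range_coe] at e
  rw [← e]
  exact IsInducing.subtypeVal.isPreconnected_image.2 h2.isPreconnected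

/-- The homomorphism to the homeomorphism group given by an action by continuous maps. -/
def homeomorphHom {G M : Type*} [Group G] [TopologicalSpace M] (f : G → M → M)
    (hc : ∀ g, Continuous (f g)) (h1 : ∀ x, f 1 x = x)
    (hmul : ∀ g g' x, f (g * g') x = f g (f g' x)) : G →* (M ≃ₜ M) where
  toFun g :=
    { toFun := f g
      invFun := f g⁻¹
      left_inv := fun x => by rw [← hmul, inv_mul_cancel, h1]
      right_inv := fun x => by rw [← hmul, mul_inv_cancel, h1]
      continuous_toFun := hc g
      continuous_invFun := hc g⁻¹ }
  map_one' := by ext x; exact h1 x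
  map_mul' g g' := by ext x; exact hmul g g' x

/-- The inverse of `f g` is `f g⁻¹`, so smoothness of each map suffices; compactness makes `h`
closed, so connected fibres suffice. -/
theorem exists_blowUp_of_maps {E : Type*} [NormedAddCommGroup E] [NormedSpace ℝ E]
    {H : Type*} [TopologicalSpace H] (I : ModelWithCorners ℝ E H)
    {M : Type*} [TopologicalSpace M] [ChartedSpace H M] [CompactSpace M] [T2Space M]
    {G : Type*} [Group G] (ρ : G →* (M ≃ₜ M)) (X : Set M) (f : G → M → M)
    (hf : ∀ g, ContMDiff I I 1 (f g)) (h1 : ∀ x, f 1 x = x)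
    (hmul : ∀ g g' x, f (g * g') x = f g (f g' x))
    (h : M → M) (hc : Continuous h) (hfib : ∀ y, IsConnected (h ⁻¹' {y}))
    (heq : ∀ g x, h (f g x) = ρ g (h x)) (hX : ∀ y, (h ⁻¹' {y}).Nontrivial ↔ y ∈ X) :
    ∃ ρ' : G →* (M ≃ₜ M), IsC1Action I ρ' ∧ IsBlowUpAlong ρ' ρ X := by
  refine ⟨homeomorphHom f (fun g => (hf g).continuous) h1 hmul, fun g => ?_, h, ?_, hX⟩
  · exact ⟨⟨(homeomorphHom f (fun g => (hf g).continuous) h1 hmul g).toEquiv, hf g, hf g⁻¹⟩,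
      fun x => rfl⟩
  · exact ⟨hc, fun y => (hfib y).nonempty, fun J hJ =>
      hc.isClosedMap.isPreconnected_preimage_of_fibers hc hfib hJ, heq⟩

/-- Conjugation of an action by a homeomorphism. -/
def conjHom {G M N : Type*} [Group G] [TopologicalSpace M] [TopologicalSpace N] (e : M ≃ₜ N)
    (ρ : G →* (M ≃ₜ M)) : G →* (N ≃ₜ N) where
  toFun g := (e.symm.trans (ρ g)).trans e
  map_one' := by ext x; simp
  map_mul' g g' := by ext x; simp

@[simp] lemma conjHom_apply {G M N : Type*} [Group G] [TopologicalSpace M] [TopologicalSpace N]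
    (e : M ≃ₜ N) (ρ : G →* (M ≃ₜ M)) (g : G) (x : N) :
    conjHom e ρ g x = e (ρ g (e.symm x)) := rfl

lemma HasSubexpOrbitGrowth.conj {G M N : Type*} [Group G] [TopologicalSpace M]
    [TopologicalSpace N] (e : M ≃ₜ N) {ρ : G →* (M ≃ₜ M)} (hρ : HasSubexpOrbitGrowth ρ) :
    HasSubexpOrbitGrowth (conjHom e ρ) := by
  intro S hS hne x
  refine (hρ S hS hne (e.symm x)).congr fun n => ?_
  have : (fun g => conjHom e ρ g x) '' (S ^ n) = e '' ((fun g => ρ g (e.symm x)) '' (S ^ n)) := by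
    rw [image_image]; rfl
  rw [this, ncard_image_of_injective _ e.injective]

theorem exists_blowUp_of_diffeomorph {G : Type*} [Group G]
    {E : Type*} [NormedAddCommGroup E] [NormedSpace ℝ E]
    {H : Type*} [TopologicalSpace H] {I : ModelWithCorners ℝ E H}
    {M : Type*} [TopologicalSpace M] [ChartedSpace H M]
    {E' : Type*} [NormedAddCommGroup E'] [NormedSpace ℝ E']
    {H' : Type*} [TopologicalSpace H'] {I' : ModelWithCorners ℝ E' H'}
    {N : Type*} [TopologicalSpace N] [ChartedSpace H' N] (e : Diffeomorph I I' M N 1)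
    (hN : ∀ ρ : G →* (N ≃ₜ N), HasSubexpOrbitGrowth ρ → ∀ X : Set N, X.Countable → Dense X →
      (∀ (g : G), ∀ x ∈ X, ρ g x ∈ X) →
      ∃ ρ' : G →* (N ≃ₜ N), IsC1Action I' ρ' ∧ IsBlowUpAlong ρ' ρ X)
    (ρ : G →* (M ≃ₜ M)) (hρ : HasSubexpOrbitGrowth ρ) (X : Set M) (hXc : X.Countable)
    (hXd : Dense X) (hX : ∀ (g : G), ∀ x ∈ X, ρ g x ∈ X) :
    ∃ ρ' : G →* (M ≃ₜ M), IsC1Action I ρ' ∧ IsBlowUpAlong ρ' ρ X := by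
  set φ := e.toHomeomorph with hφ
  obtain ⟨ρ', hC, h, hh, hfib⟩ := hN (conjHom φ ρ) (hρ.conj φ) (φ '' X) (hXc.image φ)
    (φ.surjective.denseRange.dense_image φ.continuous hXd) (by
      rintro g _ ⟨x, hx, rfl⟩
      exact ⟨ρ g x, hX g x hx, by simp⟩)
  refine ⟨conjHom φ.symm ρ', fun g => ?_, φ.symm ∘ h ∘ φ, ⟨?_, ?_, ?_, ?_⟩, fun y => ?_⟩
  · obtain ⟨ψ, hψ⟩ := hC g
    refine ⟨(e.trans ψ).trans e.symm, fun x => ?_⟩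
    change e.symm (ψ (e x)) = e.symm (ρ' g (e x))
    rw [hψ]
  · exact φ.symm.continuous.comp (hh.continuous.comp φ.continuous)
  · exact φ.symm.surjective.comp (hh.surjective.comp φ.surjective)
  · intro J hJ
    have e1 : (φ.symm ∘ h ∘ φ) ⁻¹' J = φ.symm '' (h ⁻¹' (φ '' J)) := by
      rw [φ.symm.image_eq_preimage_symm, φ.image_eq_preimage_symm]
      rfl
    rw [e1]
    exact (hh.preimage_connected _ (hJ.image φ φ.continuous.continuousOn)).image _
      φ.symm.continuous.continuousOn
  · intro g x
    have := hh.equivariant g (φ x)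
    simp only [conjHom_apply, Function.comp_apply, Homeomorph.symm_symm, Homeomorph.apply_symm_apply]
      at this ⊢
    rw [this, Homeomorph.symm_apply_apply]
  · have e1 : (φ.symm ∘ h ∘ φ) ⁻¹' {y} = φ.symm '' (h ⁻¹' {φ y}) := by
      rw [φ.symm.image_eq_preimage_symm]
      ext x
      simp only [mem_preimage, Function.comp_apply, mem_singleton_iff, Homeomorph.symm_symm]
      exact φ.toEquiv.symm_apply_eq
    rw [e1]
    have e2 : φ y ∈ φ '' X ↔ y ∈ X := φ.injective.mem_set_image
    rw [← e2, ← hfib]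
    exact ⟨fun h' => Set.nontrivial_of_image _ _ h', fun h' => h'.image φ.symm.injective⟩

/-- The orbit of a countable dense set. -/
lemma exists_countable_dense_invariant {G M : Type*} [Group G] [Countable G] [TopologicalSpace M]
    [TopologicalSpace.SeparableSpace M] (ρ : G →* (M ≃ₜ M)) :
    ∃ X : Set M, X.Countable ∧ Dense X ∧ ∀ (g : G), ∀ x ∈ X, ρ g x ∈ X := by
  obtain ⟨Y, hYc, hYd⟩ := TopologicalSpace.exists_countable_dense M
  refine ⟨⋃ g : G, ρ g '' Y, countable_iUnion fun g => hYc.image _, hYd.mono ?_, ?_⟩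
  · intro y hy
    exact mem_iUnion.2 ⟨1, y, hy, by simp⟩
  · intro g x hx
    obtain ⟨g', y, hy, rfl⟩ := mem_iUnion.1 hx
    exact mem_iUnion.2 ⟨g * g', y, hy, by simp⟩

end Assembly

/-! ### Orientation signs and fibres of the collapsing map -/

section Blowup

variable {D : Set ℝ} {w c h : ℝ → ℝ} {σ τ : ℝ} {F F' : ℝ → ℝ}

/-- One common increment decides the orientation. It applies to maps differing by a constant, such
as two lifts of a circle map. -/
lemma sign_unique (hσ : σ = 1 ∨ σ = -1) (hτ : τ = 1 ∨ τ = -1)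
    (h1 : ∀ x ∈ D, ∀ y ∈ D, x < y → σ * F x < σ * F y)
    (h2 : ∀ x ∈ D, ∀ y ∈ D, x < y → τ * F' x < τ * F' y) {a b : ℝ} (ha : a ∈ D) (hb : b ∈ D)
    (hab : a < b) (he : F b - F a = F' b - F' a) : σ = τ := by
  have h3 := h1 a ha b hb hab
  have h4 := h2 a ha b hb hab
  rcases hσ with rfl | rfl <;> rcases hτ with rfl | rfl <;> first | rfl | (exfalso; linarith)

lemma sign_mul_strictMono (hτ : τ = 1 ∨ τ = -1)
    (h1 : ∀ x ∈ D, ∀ y ∈ D, x < y → σ * F x < σ * F y)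
    (h2 : ∀ x ∈ D, ∀ y ∈ D, x < y → τ * F' x < τ * F' y) (hF' : ∀ x ∈ D, F' x ∈ D) :
    ∀ x ∈ D, ∀ y ∈ D, x < y → (σ * τ) * (F ∘ F') x < (σ * τ) * (F ∘ F') y := by
  intro x hx y hy hxy
  have h3 := h2 x hx y hy hxy
  simp only [Function.comp_apply]
  rcases hτ with rfl | rfl
  · have := h1 _ (hF' x hx) _ (hF' y hy) (by linarith)
    linarith
  · have := h1 _ (hF' y hy) _ (hF' x hx) (by linarith)
    linarith

lemma GapData.collapse_center (H : GapData D w c h) {x : ℝ} (hx : x ∈ D) :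
    c x ∈ D ∧ h (c x) = x :=
  H.of_abs_sub_le x hx (c x) (by rw [sub_self, abs_zero]; linarith [H.nonneg x])

lemma GapData.preimage_collapse (H : GapData D w c h) {x : ℝ} (hx : x ∈ D) :
    {t | t ∈ D ∧ h t = x} = Icc (c x - w x / 2) (c x + w x / 2) := by
  ext t
  have e : t ∈ Icc (c x - w x / 2) (c x + w x / 2) ↔ |t - c x| ≤ w x / 2 := by
    rw [mem_Icc, abs_le]
    constructor <;> rintro ⟨h1, h2⟩ <;> constructor <;> linarith
  rw [e]
  constructor
  · rintro ⟨ht, rfl⟩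
    exact H.abs_sub_le t ht
  · exact H.of_abs_sub_le x hx t

end Blowup

/-! ### The case of the interval -/

section Interval

lemma exists_sign_of_homeomorph_Icc (φ : Icc (0 : ℝ) 1 ≃ₜ Icc (0 : ℝ) 1) :
    ∃ σ : ℝ, (σ = 1 ∨ σ = -1) ∧ ∀ x y : Icc (0 : ℝ) 1, x < y →
      σ * (φ x : ℝ) < σ * (φ y : ℝ) := by
  rcases φ.continuous.strictMono_of_inj φ.injective with h | h
  · refine ⟨1, Or.inl rfl, fun x y hxy => ?_⟩
    have : (φ x : ℝ) < φ y := h hxy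
    linarith
  · refine ⟨-1, Or.inr rfl, fun x y hxy => ?_⟩
    have : (φ y : ℝ) < φ x := h hxy
    linarith

/-- The map factors through the line: inclusion, then `f`, then the projection onto `[0, 1]`, which
is smooth there. -/
lemma contMDiff_Icc_of_contDiff {f : ℝ → ℝ} (hf : ContDiff ℝ 1 f)
    (φ : Icc (0 : ℝ) 1 → Icc (0 : ℝ) 1) (h : ∀ x : Icc (0 : ℝ) 1, f x = φ x) : ContMDiff (𝓡∂ 1) (𝓡∂ 1) 1 φ := by
  have h1 : ContMDiff (𝓡∂ 1) 𝓘(ℝ, ℝ) 1 (fun x : Icc (0 : ℝ) 1 => f x) :=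
    hf.contMDiff.comp contMDiff_subtypeVal_Icc
  have h2 := (contMDiffOn_projIcc (x := 0) (y := 1) (n := 1)).comp_contMDiff h1
    (fun x => by rw [h]; exact (φ x).2)
  refine h2.congr fun x => ?_
  rw [Function.comp_apply, h, projIcc_val]

theorem exists_blowUp_Icc {G : Type*} [Group G] [Countable G]
    (ρ : G →* (Icc (0 : ℝ) 1 ≃ₜ Icc (0 : ℝ) 1)) (hρ : HasSubexpOrbitGrowth ρ)
    (X : Set (Icc (0 : ℝ) 1)) (hXc : X.Countable) (hXd : Dense X)
    (hX : ∀ (g : G), ∀ x ∈ X, ρ g x ∈ X) :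
    ∃ ρ' : G →* (Icc (0 : ℝ) 1 ≃ₜ Icc (0 : ℝ) 1),
      IsC1Action (𝓡∂ 1) ρ' ∧ IsBlowUpAlong ρ' ρ X := by
  obtain ⟨l, hl0, hlX, hlsum, hlfin⟩ :=
    exists_asymptotically_invariant_weight ρ hρ hXc hXd.nonempty hX
  set v : ℝ → ℝ := Function.extend Subtype.val l 0 with hv
  have hvval : ∀ x : Icc (0 : ℝ) 1, v x = l x := fun x => Subtype.val_injective.extend_apply _ _ x
  have hvD : ∀ x, x ∉ Icc (0 : ℝ) 1 → v x = 0 := fun x hx =>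
    Function.extend_apply' _ _ _ (by rintro ⟨y, rfl⟩; exact hx y.2)
  have hA : AtomicWeight v := by
    refine ⟨fun x => ?_, fun x hx => ?_, (hasSum_extend_zero Subtype.val_injective).2 hlsum, ?_⟩
    · by_cases hx : x ∈ Icc (0 : ℝ) 1
      · rw [hvval ⟨x, hx⟩]; exact hl0 _
      · rw [hvD x hx]
    · by_contra h; exact hx (hvD x h)
    · intro x hx y hy hxy
      obtain ⟨z, hzX, hz⟩ := hXd.exists_between (show (⟨x, hx⟩ : Icc (0 : ℝ) 1) < ⟨y, hy⟩ from hxy)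
      exact ⟨z, ⟨hz.1, hz.2⟩, by rw [hvval]; exact (hlX z).2 hzX⟩
  have H := hA.gapData
  set c := gapCenter v
  set h := collapse v
  set F : G → ℝ → ℝ := fun g => IccExtend zero_le_one fun x => (ρ g x : ℝ) with hFdef
  have hFval : ∀ g (x : Icc (0 : ℝ) 1), F g x = ρ g x := fun g x => IccExtend_val _ _ x
  choose σ hσ hσF using fun g => exists_sign_of_homeomorph_Icc (ρ g)
  have hstrict : ∀ g, ∀ x ∈ Icc (0 : ℝ) 1, ∀ y ∈ Icc (0 : ℝ) 1, x < y → σ g * F g x < σ g * F g y := by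
    intro g x hx y hy hxy
    rw [hFval g ⟨x, hx⟩, hFval g ⟨y, hy⟩]
    exact hσF g ⟨x, hx⟩ ⟨y, hy⟩ hxy
  have hmaps : ∀ g, ∀ x ∈ Icc (0 : ℝ) 1, F g x ∈ Icc (0 : ℝ) 1 := fun g x hx => by
    rw [hFval g ⟨x, hx⟩]; exact (ρ g ⟨x, hx⟩).2
  have hGH : ∀ g, GapHomeo (Icc 0 1) v (σ g) (F g) := by
    intro g
    refine ⟨hσ g, hmaps g, fun y hy => ?_, hstrict g, fun x hx => ?_, fun ε hε a b => ?_⟩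
    · exact ⟨(ρ g).symm ⟨y, hy⟩, Subtype.prop _, by rw [hFval]; simp⟩
    · rw [hFval g ⟨x, hx⟩, hvval, hvval ⟨x, hx⟩, ← not_iff_not]
      change l _ ≠ 0 ↔ l _ ≠ 0
      rw [hlX, hlX]
      refine ⟨fun h' => ?_, hX g _⟩
      simpa using hX g⁻¹ _ h'
    · refine ((hlfin g ε hε).image Subtype.val).subset ?_
      rintro x ⟨hx, -, hx0, hxε⟩
      rw [hFval g ⟨x, hx⟩, hvval, hvval ⟨x, hx⟩] at hxε
      rw [hvval ⟨x, hx⟩] at hx0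
      exact ⟨⟨x, hx⟩, ⟨(hlX _).1 hx0, hxε⟩, rfl⟩
  have hmem : ∀ g, ∀ t ∈ Icc (0 : ℝ) 1, blowup v c h (σ g) (F g) t ∈ Icc (0 : ℝ) 1 ∧
      h (blowup v c h (σ g) (F g) t) = F g (h t) := fun g t ht =>
    H.blowup_mem (hσ g) ht (hmaps g _ (H.mapsTo t ht))
  have h0D : (0 : ℝ) ∈ Icc (0 : ℝ) 1 := ⟨le_rfl, zero_le_one⟩
  have h1D : (1 : ℝ) ∈ Icc (0 : ℝ) 1 := ⟨zero_le_one, le_rfl⟩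
  have hFone : ∀ x ∈ Icc (0 : ℝ) 1, F 1 x = x := fun x hx => by rw [hFval 1 ⟨x, hx⟩]; simp
  have hFmul : ∀ g g', ∀ x ∈ Icc (0 : ℝ) 1, F (g * g') x = F g (F g' x) := fun g g' x hx => by
    rw [hFval _ ⟨x, hx⟩, hFval g' ⟨x, hx⟩, hFval]; simp
  have hσone : σ 1 = 1 := sign_unique (D := Icc (0 : ℝ) 1) (F := F 1) (F' := id) (hσ 1) (Or.inl rfl)
    (hstrict 1) (fun x _ y _ hxy => by simpa using hxy) h0D h1D zero_lt_one
    (by rw [hFone 0 h0D, hFone 1 h1D]; rfl)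
  -- The sign enters the formula for the blow-up, so it must be multiplicative for the blow-ups to
  -- compose.
  have hσmul : ∀ g g', σ (g * g') = σ g * σ g' := by
    intro g g'
    refine sign_unique (D := Icc (0 : ℝ) 1) (F := F (g * g')) (F' := F g ∘ F g') (hσ _) ?_ (hstrict _)
      (sign_mul_strictMono (hσ g') (hstrict g) (hstrict g') (hmaps g')) h0D h1D zero_lt_one
      (by rw [hFmul g g' 0 h0D, hFmul g g' 1 h1D]; rfl)
    rcases hσ g with h1 | h1 <;> rcases hσ g' with h2 | h2 <;> rw [h1, h2] <;> norm_num
  refine exists_blowUp_of_maps (𝓡∂ 1) ρ X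
    (fun g t => ⟨blowup v c h (σ g) (F g) t, (hmem g t t.2).1⟩) (fun g => ?_) (fun t => ?_)
    (fun g g' t => ?_) (fun t => ⟨h t, H.mapsTo t t.2⟩) ?_ (fun y => ?_) (fun g t => ?_) (fun y => ?_)
  · obtain ⟨f, hf, hfe⟩ := (hGH g).exists_contDiff H
    exact contMDiff_Icc_of_contDiff hf _ fun x => hfe x.2
  · refine Subtype.ext ?_
    have hht := hFone _ (H.mapsTo _ t.2)
    simp only [hσone]
    rw [H.blowup_of_weight_eq t.2 (by rw [hht]), hht, sub_self, add_zero]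
  · refine Subtype.ext ?_
    have hht := H.mapsTo _ t.2
    simp only
    rw [H.blowup_blowup (hσ g') t.2 (hmaps g' _ hht) ((hGH g').weight_eq_zero _ hht), ← hσmul]
    simp only [blowup, Function.comp_apply, hFmul g g' _ hht]
  · refine Monotone.continuous_of_surjective (fun s t hst => H.monotoneOn s.2 t.2 hst) fun y => ?_
    obtain ⟨h1, h2⟩ := H.collapse_center y.2
    exact ⟨⟨c y, h1⟩, Subtype.ext h2⟩
  -- Only the two goals about the fibre over `y` receive this description of it as a gap.
  all_goals try
    have e : (Subtype.val '' ((fun t : Icc (0 : ℝ) 1 => (⟨h t, H.mapsTo t t.2⟩ : Icc (0 : ℝ) 1)) ⁻¹' {y}) : Set ℝ) =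
        Icc (c y - v y / 2) (c y + v y / 2) := by
      rw [← H.preimage_collapse y.2]
      ext t
      simp only [mem_image, mem_preimage, mem_singleton_iff, Subtype.exists, exists_and_right,
        exists_eq_right, Subtype.ext_iff, exists_prop]
      rfl
  · have hle : c y - v y / 2 ≤ c y + v y / 2 := by linarith [H.nonneg y]
    refine ⟨?_, ?_⟩
    · have : (Icc (c y - v y / 2) (c y + v y / 2)).Nonempty := nonempty_Icc.2 hle
      rw [← e] at this
      exact this.of_image
    · rw [← IsInducing.subtypeVal.isPreconnected_image, e]
      exact isPreconnected_Icc
  · refine Subtype.ext ?_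
    rw [← hFval]
    exact (hmem g t t.2).2
  · rw [← hlX, ← hvval]
    constructor
    · intro h1 h2
      have := h1.image Subtype.val_injective
      rw [e, h2] at this
      simp at this
    · intro h1
      have h2 := lt_of_le_of_ne (H.nonneg y) h1.symm
      refine Set.nontrivial_of_image Subtype.val _ ?_
      rw [e]
      exact (Icc_infinite (by linarith)).nontrivial

end Interval

/-! ### The universal covering of the circle -/

section CircleCover

/-- The universal covering of the circle, with deck group `ℤ`. -/
noncomputable def circleCover (t : ℝ) : Circle := Circle.exp (2 * Real.pi * t)

lemma circleCover_eq_iff {s t : ℝ} : circleCover s = circleCover t ↔ ∃ n : ℤ, s = t + n := by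
  have hπ := Real.pi_pos
  rw [circleCover, circleCover, Circle.exp_eq_exp]
  refine exists_congr fun n => ⟨fun h => ?_, fun h => ?_⟩
  · have : 2 * Real.pi * s = 2 * Real.pi * (t + n) := by rw [h]; ring
    exact mul_left_cancel₀ (by positivity) this
  · rw [h]; ring

lemma circleCover_add_int (t : ℝ) (n : ℤ) : circleCover (t + n) = circleCover t :=
  circleCover_eq_iff.2 ⟨n, rfl⟩

lemma circleCover_fract (t : ℝ) : circleCover (Int.fract t) = circleCover t :=
  circleCover_eq_iff.2 ⟨-⌊t⌋, by rw [Int.fract]; push_cast; ring⟩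

/-- A lift of the points of the circle, near `z₀`. -/
noncomputable def circleLift (z₀ z : Circle) : ℝ :=
  (Complex.arg (z₀ : ℂ) + Complex.arg ((z / z₀ : Circle) : ℂ)) / (2 * Real.pi)

lemma circleCover_circleLift (z₀ z : Circle) : circleCover (circleLift z₀ z) = z := by
  have hπ := Real.pi_pos
  rw [circleCover, circleLift, mul_div_cancel₀ _ (by positivity), Circle.exp_add, Circle.exp_arg,
    Circle.exp_arg, mul_div_cancel]

lemma circleCover_surjective : Function.Surjective circleCover := fun z =>
  ⟨_, circleCover_circleLift 1 z⟩

lemma continuous_circleCover : Continuous circleCover :=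
  Circle.exp.continuous.comp (by fun_prop)

lemma isOpenMap_circleCover : IsOpenMap circleCover := by
  have h1 : IsOpenMap fun t : ℝ => 2 * Real.pi * t :=
    (Homeomorph.mulLeft₀ (2 * Real.pi) (by positivity)).isOpenMap
  exact Circle.isCoveringMap_exp.isLocalHomeomorph.isOpenMap.comp h1

lemma contMDiff_circleCover : ContMDiff 𝓘(ℝ, ℝ) (𝓡 1) 1 circleCover := by
  have h1 : ContDiff ℝ 1 fun t : ℝ => 2 * Real.pi * t := by fun_prop
  exact contMDiff_circleExp.comp h1.contMDiff

attribute [local instance] finrank_real_complex_fact' in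
lemma contMDiff_circle_coe : ContMDiff (𝓡 1) 𝓘(ℝ, ℂ) 1 fun z : Circle => (z : ℂ) :=
  contMDiff_coe_sphere (E := ℂ) (n := 1)

lemma contMDiffAt_circleLift (z₀ : Circle) : ContMDiffAt (𝓡 1) 𝓘(ℝ, ℝ) 1 (circleLift z₀) z₀ := by
  have h1 : ContMDiffAt (𝓡 1) 𝓘(ℝ, ℂ) 1 (fun z : Circle => (z : ℂ) / (z₀ : ℂ)) z₀ := by
    have : ContDiff ℝ 1 fun z : ℂ => z / (z₀ : ℂ) := contDiff_id.div_const _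
    exact (this.contMDiff.comp contMDiff_circle_coe).contMDiffAt
  have h2 : ContDiffAt ℝ 1 (fun z : ℂ => (Complex.arg (z₀ : ℂ) + Complex.arg z) / (2 * Real.pi))
      ((z₀ : ℂ) / (z₀ : ℂ)) := by
    have h3 : ContDiffAt ℝ 1 Complex.log ((z₀ : ℂ) / (z₀ : ℂ)) := by
      rw [div_self z₀.coe_ne_zero]
      exact (Complex.contDiffAt_log Complex.one_mem_slitPlane).restrict_scalars ℝ
    have h4 : ContDiffAt ℝ 1 (fun z => (Complex.log z).im) ((z₀ : ℂ) / (z₀ : ℂ)) :=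
      Complex.imCLM.contDiff.contDiffAt.comp _ h3
    simp only [Complex.log_im] at h4
    exact (contDiffAt_const.add h4).div_const _
  exact h2.contMDiffAt.comp z₀ h1

/-- A continuous integer-valued function on a connected space is constant; thus two lifts of one map
differ by a single deck translation. -/
lemma exists_int_forall_eq {f : ℝ → ℝ} (hf : Continuous f) (h : ∀ t, ∃ n : ℤ, f t = n) :
    ∃ n : ℤ, ∀ t, f t = n := by
  choose N hN using h
  have hc : Continuous N := by
    rw [Int.isClosedEmbedding_coe_real.isEmbedding.continuous_iff]
    exact hf.congr hN
  exact ⟨N 0, fun t => by rw [hN t, PreconnectedSpace.constant inferInstance hc (x := t) (y := 0)]⟩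

lemma exists_lift_circleCover (φ : Circle ≃ₜ Circle) :
    ∃ F : ℝ → ℝ, Continuous F ∧ ∀ t, circleCover (F t) = φ (circleCover t) := by
  have hπ := Real.pi_pos
  obtain ⟨θ, hθ⟩ := circleCover_surjective (φ (circleCover 0))
  obtain ⟨Φ, ⟨-, hΦ⟩, -⟩ := Circle.isCoveringMap_exp.existsUnique_continuousMap_lifts
    ⟨fun t => φ (circleCover t), φ.continuous.comp continuous_circleCover⟩ 0 (2 * Real.pi * θ) hθ
  refine ⟨fun t => Φ t / (2 * Real.pi), Φ.continuous.div_const _, fun t => ?_⟩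
  rw [circleCover, mul_div_cancel₀ _ (by positivity)]
  exact congrFun hΦ t

lemma finite_setOf_circleCover_mem {S : Set Circle} (hS : S.Finite) (a b : ℝ) :
    {x | x ∈ Icc a b ∧ circleCover x ∈ S}.Finite := by
  have hfin : (Icc ⌊a⌋ ⌊b⌋ ×ˢ S).Finite := (Set.finite_Icc _ _).prod hS
  -- A real number is determined by its integer part and its image on the circle.
  refine Set.Finite.of_injOn (f := fun x => (⌊x⌋, circleCover x)) ?_ ?_ hfin
  · rintro x ⟨hx, hxS⟩
    exact ⟨⟨Int.floor_mono hx.1, Int.floor_mono hx.2⟩, hxS⟩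
  · rintro x - y - hxy
    simp only [Prod.mk.injEq] at hxy
    obtain ⟨n, hn⟩ := circleCover_eq_iff.1 hxy.2
    have h1 := hxy.1
    rw [hn, Int.floor_add_intCast] at h1
    have : n = 0 := by omega
    rw [hn, this]; simp

end CircleCover

/-! ### The case of the circle -/

section CircleCase

/-- The chosen lifts form an action only up to integer translations. The gap data are periodic, so
this ambiguity disappears after projection to the circle. -/
theorem exists_blowUp_circle {G : Type*} [Group G] [Countable G]
    (ρ : G →* (Circle ≃ₜ Circle)) (hρ : HasSubexpOrbitGrowth ρ)
    (X : Set Circle) (hXc : X.Countable) (hXd : Dense X)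
    (hX : ∀ (g : G), ∀ x ∈ X, ρ g x ∈ X) :
    ∃ ρ' : G →* (Circle ≃ₜ Circle), IsC1Action (𝓡 1) ρ' ∧ IsBlowUpAlong ρ' ρ X := by
  obtain ⟨l, hl0, hlX, hlsum, hlfin⟩ :=
    exists_asymptotically_invariant_weight ρ hρ hXc hXd.nonempty hX
  -- The half-open interval counts every point of the circle once and leaves no atom at 1, as the
  -- periodic extension requires.
  set v : ℝ → ℝ := (Ico (0 : ℝ) 1).indicator fun x => l (circleCover x) with hv
  have hv1 : v 1 = 0 := indicator_of_notMem (by simp) _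
  have hA : AtomicWeight v := by
    refine ⟨fun x => indicator_nonneg (fun _ _ => hl0 _) _, fun x hx => ?_, ?_, ?_⟩
    · exact Ico_subset_Icc_self (mem_of_indicator_ne_zero hx)
    · have hbij : Function.Bijective fun x : Ico (0 : ℝ) 1 => circleCover x := by
        refine ⟨fun x y hxy => ?_, fun z => ?_⟩
        · obtain ⟨n, hn⟩ := circleCover_eq_iff.1 hxy
          have h1 := x.2.1
          have h2 := x.2.2
          have h3 := y.2.1
          have h4 := y.2.2
          have h5 : n < 1 := by exact_mod_cast (by linarith : (n : ℝ) < 1)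
          have h6 : -1 < n := by exact_mod_cast (by linarith : (-1 : ℝ) < n)
          have h7 : n = 0 := by omega
          exact Subtype.ext (by rw [hn, h7]; simp)
        · obtain ⟨t, rfl⟩ := circleCover_surjective z
          exact ⟨⟨Int.fract t, Int.fract_nonneg t, Int.fract_lt_one t⟩, circleCover_fract t⟩
      rw [hv, ← hasSum_subtype_iff_indicator]
      exact (Equiv.ofBijective _ hbij).hasSum_iff.2 hlsum
    · intro x hx y hy hxy
      obtain ⟨z, hzX, hz⟩ := (hXd.preimage isOpenMap_circleCover).exists_between hxy
      refine ⟨z, hz, ?_⟩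
      rw [hv, indicator_of_mem (show z ∈ Ico (0 : ℝ) 1 from ⟨hx.1.trans hz.1.le, hz.2.trans_le hy.2⟩)]
      exact (hlX _).2 hzX
  have H := hA.gapData.periodic hv1 (by
    have := hA.lowerMass_one_add
    rw [gapCenter]; linarith)
  set w : ℝ → ℝ := fun x => v (Int.fract x) with hw
  set c : ℝ → ℝ := fun x => ⌊x⌋ + gapCenter v (Int.fract x) with hc
  set h : ℝ → ℝ := fun t => ⌊t⌋ + collapse v (Int.fract t) with hh
  have hwl : ∀ x, w x = l (circleCover x) := fun x => by
    rw [hw, hv]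
    simp only
    rw [indicator_of_mem (show Int.fract x ∈ Ico (0 : ℝ) 1 from
      ⟨Int.fract_nonneg x, Int.fract_lt_one x⟩), circleCover_fract]
  have hc_add : ∀ x (n : ℤ), c (x + n) = c x + n := fun x n => by
    simp only [hc, Int.floor_add_intCast, Int.fract_add_intCast]; push_cast; ring
  have hh_add : ∀ x (n : ℤ), h (x + n) = h x + n := fun x n => by
    simp only [hh, Int.floor_add_intCast, Int.fract_add_intCast]; push_cast; ring
  have hw_add : ∀ x (n : ℤ), w (x + n) = w x := fun x n => by
    simp only [hw, Int.fract_add_intCast]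
  clear_value w c h
  choose F hFc hFlift using fun g => exists_lift_circleCover (ρ g)
  have hFone : ∃ n : ℤ, ∀ t, F 1 t - t = n := by
    refine exists_int_forall_eq ((hFc 1).sub continuous_id) fun t => ?_
    obtain ⟨n, hn⟩ := circleCover_eq_iff.1 (show circleCover (F 1 t) = circleCover t by
      rw [hFlift]; simp)
    exact ⟨n, by rw [hn]; ring⟩
  have hFmul : ∀ g g', ∃ n : ℤ, ∀ t, F (g * g') t - F g (F g' t) = n := by
    intro g g'
    refine exists_int_forall_eq ((hFc _).sub ((hFc g).comp (hFc g'))) fun t => ?_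
    obtain ⟨n, hn⟩ := circleCover_eq_iff.1
      (show circleCover (F (g * g') t) = circleCover (F g (F g' t)) by
        rw [hFlift, hFlift, hFlift]; simp)
    exact ⟨n, by rw [hn]; ring⟩
  have hFinv : ∀ g g', g * g' = 1 → ∃ n : ℤ, ∀ t, F g (F g' t) = t + n := by
    intro g g' hgg
    obtain ⟨n, hn⟩ := hFone
    obtain ⟨m, hm⟩ := hFmul g g'
    rw [hgg] at hm
    refine ⟨n - m, fun t => ?_⟩
    push_cast
    linarith [hn t, hm t]
  have hFinj : ∀ g, Function.Injective (F g) := by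
    intro g s t hst
    obtain ⟨n, hn⟩ := hFinv g⁻¹ g (inv_mul_cancel g)
    have h1 := hn s
    rw [hst, hn t] at h1
    linarith
  have hFsurj : ∀ g, Function.Surjective (F g) := by
    intro g t
    obtain ⟨n, hn⟩ := hFinv g g⁻¹ (mul_inv_cancel g)
    exact ⟨F g⁻¹ (t - n), by rw [hn]; ring⟩
  have hsign : ∀ g, ∃ σ : ℝ, (σ = 1 ∨ σ = -1) ∧ ∀ x ∈ (univ : Set ℝ), ∀ y ∈ (univ : Set ℝ),
      x < y → σ * F g x < σ * F g y := by
    intro g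
    rcases (hFc g).strictMono_of_inj (hFinj g) with hm | hm
    · exact ⟨1, Or.inl rfl, fun x _ y _ hxy => by linarith [hm hxy]⟩
    · exact ⟨-1, Or.inr rfl, fun x _ y _ hxy => by linarith [hm hxy]⟩
  choose σ hσ hstrict using hsign
  have hGH : ∀ g, GapHomeo univ w (σ g) (F g) := by
    intro g
    refine ⟨hσ g, fun _ _ => mem_univ _, (hFsurj g).surjOn, hstrict g, fun x _ => ?_,
      fun ε hε a b => ?_⟩
    · rw [hwl, hwl, hFlift, ← not_iff_not]
      change l _ ≠ 0 ↔ l _ ≠ 0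
      rw [hlX, hlX]
      refine ⟨fun h' => ?_, hX g _⟩
      simpa using hX g⁻¹ _ h'
    · refine (finite_setOf_circleCover_mem (hlfin g ε hε) a b).subset ?_
      rintro x ⟨-, hx, hx0, hxε⟩
      rw [hwl, hwl, hFlift] at hxε
      rw [hwl, hlX] at hx0
      exact ⟨hx, hx0, hxε⟩
  have hσone : σ 1 = 1 := by
    obtain ⟨n, hn⟩ := hFone
    refine sign_unique (D := univ) (F := F 1) (F' := id) (hσ 1) (Or.inl rfl) (hstrict 1)
      (fun x _ y _ hxy => by simpa using hxy) (mem_univ 0) (mem_univ 1) zero_lt_one ?_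
    simp only [id]
    linarith [hn 0, hn 1]
  have hσmul : ∀ g g', σ (g * g') = σ g * σ g' := by
    intro g g'
    obtain ⟨n, hn⟩ := hFmul g g'
    refine sign_unique (D := univ) (F := F (g * g')) (F' := F g ∘ F g') (hσ _) ?_ (hstrict _)
      (sign_mul_strictMono (hσ g') (hstrict g) (hstrict g') fun _ _ => mem_univ _)
      (mem_univ 0) (mem_univ 1) zero_lt_one ?_
    · rcases hσ g with h1 | h1 <;> rcases hσ g' with h2 | h2 <;> rw [h1, h2] <;> norm_num
    · simp only [Function.comp_apply]
      linarith [hn 0, hn 1]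
  -- The projected blow-up depends only on the point and the value of the map downstairs, given the
  -- sign; well-definedness and multiplicativity both follow.
  have hblow : ∀ (τ : ℝ) (F₁ F₂ : ℝ → ℝ) (s t : ℝ), circleCover s = circleCover t →
      circleCover (F₁ (h s)) = circleCover (F₂ (h t)) →
      circleCover (blowup w c h τ F₁ s) = circleCover (blowup w c h τ F₂ t) := by
    intro τ F₁ F₂ s t hst hF
    obtain ⟨n, rfl⟩ := circleCover_eq_iff.1 hst
    obtain ⟨m, hm⟩ := circleCover_eq_iff.1 hF
    refine circleCover_eq_iff.2 ⟨m, ?_⟩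
    rw [hh_add] at hm
    simp only [blowup, hh_add, hm, hc_add, hw_add, add_sub_add_right_eq_sub]
    ring
  have hcirc : ∀ s t, circleCover s = circleCover t → circleCover (h s) = circleCover (h t) := by
    intro s t hst
    obtain ⟨n, rfl⟩ := circleCover_eq_iff.1 hst
    rw [hh_add, circleCover_add_int]
  -- The section `circleLift 1` need not be continuous: by `hfval` any other lift gives the same
  -- value.
  set f : G → Circle → Circle := fun g z =>
    circleCover (blowup w c h (σ g) (F g) (circleLift 1 z)) with hf
  have hfval : ∀ g t z, circleCover t = z →
      f g z = circleCover (blowup w c h (σ g) (F g) t) := by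
    intro g t z hz
    have h1 : circleCover (circleLift 1 z) = circleCover t := by rw [circleCover_circleLift, hz]
    refine hblow _ _ _ _ _ h1 ?_
    rw [hFlift, hFlift, hcirc _ _ h1]
  set k : Circle → Circle := fun z => circleCover (h (circleLift 1 z)) with hk
  have hkval : ∀ t, k (circleCover t) = circleCover (h t) := fun t =>
    hcirc _ _ (circleCover_circleLift _ _)
  have hfib : ∀ x, k ⁻¹' {circleCover x} = circleCover '' Icc (c x - w x / 2) (c x + w x / 2) := by
    intro x
    rw [← H.preimage_collapse (mem_univ x)]
    ext z
    constructor
    · intro hz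
      obtain ⟨t, rfl⟩ := circleCover_surjective z
      rw [mem_preimage, hkval, mem_singleton_iff] at hz
      obtain ⟨n, hn⟩ := circleCover_eq_iff.1 hz.symm
      exact ⟨t + n, ⟨mem_univ _, by rw [hh_add, hn]⟩, circleCover_add_int _ _⟩
    · rintro ⟨t, ⟨-, rfl⟩, rfl⟩
      exact hkval t
  refine exists_blowUp_of_maps (𝓡 1) ρ X f (fun g z₀ => ?_) (fun z => ?_) (fun g g' z => ?_) k ?_
    (fun y => ?_) (fun g z => ?_) (fun y => ?_)
  · obtain ⟨b, hb, hbe⟩ := (hGH g).exists_contDiff H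
    -- To see regularity at `z₀`, the branch of the lift is taken that is smooth at `z₀`.
    have e : f g = fun z => circleCover (b (circleLift z₀ z)) := funext fun z => by
      rw [hfval g _ z (circleCover_circleLift z₀ z), hbe (mem_univ _)]
    rw [e]
    exact contMDiff_circleCover.contMDiffAt.comp z₀
      (hb.contMDiff.contMDiffAt.comp z₀ (contMDiffAt_circleLift z₀))
  · obtain ⟨t, rfl⟩ := circleCover_surjective z
    obtain ⟨n, hn⟩ := hFone
    have e : F 1 (h t) = h t + n := by linarith [hn (h t)]
    rw [hfval 1 t _ rfl, hσone, H.blowup_of_weight_eq (mem_univ t) (by rw [e, hw_add]), e, hc_add,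
      add_sub_cancel_left, circleCover_add_int]
  · obtain ⟨t, rfl⟩ := circleCover_surjective z
    rw [hfval _ t _ rfl, hfval g' t _ rfl, hfval g _ _ rfl,
      H.blowup_blowup (hσ g') (mem_univ t) (mem_univ _) ((hGH g').weight_eq_zero _ (mem_univ _)),
      ← hσmul]
    refine hblow _ _ _ _ _ rfl ?_
    rw [Function.comp_apply, hFlift, hFlift, hFlift]
    simp
  · have hq : IsQuotientMap circleCover := isOpenMap_circleCover.isQuotientMap
      continuous_circleCover circleCover_surjective
    rw [hq.continuous_iff]
    have hhc : Continuous h := Monotone.continuous_of_surjective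
      (fun s t hst => H.monotoneOn (mem_univ s) (mem_univ t) hst)
      fun x => ⟨c x, (H.collapse_center (mem_univ x)).2⟩
    exact (continuous_circleCover.comp hhc).congr fun t => (hkval t).symm
  · obtain ⟨x, rfl⟩ := circleCover_surjective y
    rw [hfib]
    exact (isConnected_Icc (by linarith [H.nonneg x])).image _ continuous_circleCover.continuousOn
  · obtain ⟨t, rfl⟩ := circleCover_surjective z
    rw [hfval g t _ rfl, hkval, hkval,
      (H.blowup_mem (hσ g) (mem_univ t) (mem_univ _)).2, hFlift]
  · obtain ⟨x, rfl⟩ := circleCover_surjective y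
    rw [hfib, ← hlX, ← hwl]
    constructor
    · intro h1 h2
      rw [h2] at h1
      simp at h1
    · intro h1
      have h2 : 0 < w x := lt_of_le_of_ne (H.nonneg x) h1.symm
      -- The cap `1 / 2` keeps the two points of the gap from being identified by an integer
      -- translation.
      set δ := min (w x / 2) (1 / 2) with hδ
      have hδ0 : 0 < δ := lt_min (by linarith) (by norm_num)
      have hδ1 : δ ≤ w x / 2 := min_le_left _ _
      have hδ2 : δ ≤ 1 / 2 := min_le_right _ _
      refine ⟨circleCover (c x + δ), ⟨_, ⟨by linarith, by linarith⟩, rfl⟩, circleCover (c x),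
        ⟨_, ⟨by linarith, by linarith⟩, rfl⟩, fun he => ?_⟩
      obtain ⟨n, hn⟩ := circleCover_eq_iff.1 he
      have h5 : n < 1 := by exact_mod_cast (by linarith : (n : ℝ) < 1)
      have h6 : 0 < n := by exact_mod_cast (by linarith : (0 : ℝ) < n)
      omega

end CircleCase

theorem corollary3p3 {G : Type*} [Group G] [Countable G]
    {E : Type*} [NormedAddCommGroup E] [NormedSpace ℝ E]
    {H : Type*} [TopologicalSpace H] (I : ModelWithCorners ℝ E H)
    {M : Type*} [TopologicalSpace M] [ChartedSpace H M] [IsManifold I 1 M]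
    (hM : IsCompactConnectedOneManifold I M)
    (ρ : G →* (M ≃ₜ M)) (hρ : HasSubexpOrbitGrowth ρ) :
    (∃ ρ' : G →* (M ≃ₜ M), IsC1Action I ρ' ∧ IsBlowUp ρ' ρ) ∧
    ∀ X : Set M, X.Countable → Dense X → (∀ (g : G), ∀ x ∈ X, ρ g x ∈ X) →
      ∃ ρ' : G →* (M ≃ₜ M), IsC1Action I ρ' ∧ IsBlowUpAlong ρ' ρ X := by
  have along : ∀ X : Set M, X.Countable → Dense X → (∀ (g : G), ∀ x ∈ X, ρ g x ∈ X) →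
      ∃ ρ' : G →* (M ≃ₜ M), IsC1Action I ρ' ∧ IsBlowUpAlong ρ' ρ X := by
    rcases hM with ⟨⟨e⟩⟩ | ⟨⟨e⟩⟩
    · exact exists_blowUp_of_diffeomorph e exists_blowUp_Icc ρ hρ
    · exact exists_blowUp_of_diffeomorph e exists_blowUp_circle ρ hρ
  refine ⟨?_, along⟩
  have : TopologicalSpace.SeparableSpace M := by
    rcases hM with ⟨⟨e⟩⟩ | ⟨⟨e⟩⟩
    · exact e.toHomeomorph.symm.surjective.denseRange.separableSpace e.toHomeomorph.symm.continuous
    · exact e.toHomeomorph.symm.surjective.denseRange.separableSpace e.toHomeomorph.symm.continuous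
  obtain ⟨X, hXc, hXd, hX⟩ := exists_countable_dense_invariant ρ
  obtain ⟨ρ', hC, h, hh, -⟩ := along X hXc hXd hX
  exact ⟨ρ', hC, h, hh⟩
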